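/- All algebras are associative, unital, over $\mathbb{C}$. Let $G$ be a group acting on an algebra $A$ by algebra automorphisms, and regard $A$ as a module algebra over the group algebra $\mathbb{C}G$ (with comultiplication $\Delta(g)=g\otimes g$). The smash product $A\,\#\,\mathbb{C}G$ is $A\otimes\mathbb{C}G$ with the multiplication $(\mu_A\otimes\mu_{\mathbb{C}G})(1\otimes\tau\otimes 1)$, where $\tau\colon\mathbb{C}G\otimes A\to A\otimes\mathbb{C}G$ is $\tau(h\otimes a)=\sum (h_{(1)}\cdot a)\otimes h_{(2)}$; that is, $(a\otimes g)(b\otimes g')=a(g\cdot b)\otimes gg'$ for $a,b\in A$ and $g,g'\in G$. For an algebra $B$, let $\widehat{B}$ be its Arens–Michael envelope, i.e. the (Hausdorff) completion of $B$ with respect to all submultiplicative seminorms. Let $\widetilde{A}$ be the (Hausdorff) completion of $A$ with respect to all submultiplicative seminorms $\|\cdot\|$ that are $\mathbb{C}G$-stable, i.e. for every $h\in\mathbb{C}G$ there is $C>0$ with $\|h\cdot a\|\le C\|a\|$ for all $a\in A$. The comultiplication of $\mathbb{C}G$ and its action on $A$ extend by continuity to continuous linear maps $\widehat{\mathbb{C}G}\to\widehat{\mathbb{C}G}\mathbin{\widehat\otimes}\widehat{\mathbb{C}G}$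 and $\widehat{\mathbb{C}G}\mathbin{\widehat\otimes}\widetilde{A}\to\widetilde{A}$, where $\widehat\otimes$ is the completed projective tensor product. The analytic smash product $\widetilde{A}\mathbin{\widehat{\#}}\widehat{\mathbb{C}G}$ is the locally convex space $\widetilde{A}\mathbin{\widehat\otimes}\widehat{\mathbb{C}G}$ with the multiplication defined by the same formulas as above, with $\otimes$ replaced by $\widehat\otimes$; it is a $\widehat\otimes$-algebra (a complete Hausdorff locally convex algebra with jointly continuous multiplication). Then the canonical map $A\,\#\,\mathbb{C}G\to\widetilde{A}\mathbin{\widehat{\#}}\widehat{\mathbb{C}G}$, $a\otimes h\mapsto a\otimes h$, extends to an isomorphism of $\widehat\otimes$-algebras (an algebra isomorphism which is a homeomorphism) $$(A\,\#\,\mathbb{C}G)^{\wedge}\;\cong\;\widetilde{A}\mathbin{\widehat{\#}}\widehat{\mathbb{C}G}.$$ -/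

import Mathlib

open scoped TensorProduct

namespace ArensMichael

noncomputable section

set_option linter.unusedSectionVars false

section SeminormSpace

variable {V : Type*} [AddCommGroup V] [Module ℂ V]

/-- The vector space `V`, endowed with the locally convex topology generated by the set `P` of
seminorms. -/
def SeminormSpace (_P : Set (Seminorm ℂ V)) : Type _ := V

variable (P : Set (Seminorm ℂ V))

instance : AddCommGroup (SeminormSpace P) := inferInstanceAs (AddCommGroup V)

instance : Module ℂ (SeminormSpace P) := inferInstanceAs (Module ℂ V)

/-- The uniform structure (hence the topology) generated by the seminorms in `P`. -/
instance : UniformSpace (SeminormSpace P) :=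
  (⨅ p : P, p.1.toSeminormedAddCommGroup.toUniformSpace : UniformSpace V)

instance : IsUniformAddGroup (SeminormSpace P) :=
  @isUniformAddGroup_iInf V _ _ _ fun p : P =>
    @SeminormedAddCommGroup.to_isUniformAddGroup V p.1.toSeminormedAddCommGroup

theorem SeminormSpace.topology_eq :
    (inferInstance : TopologicalSpace (SeminormSpace P)) =
      (⨅ p : P, p.1.toSeminormedAddCommGroup.toUniformSpace.toTopologicalSpace :
        TopologicalSpace V) :=
  UniformSpace.toTopologicalSpace_iInf

instance : PolynormableSpace ℂ (SeminormSpace P) := by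
  have h : @PolynormableSpace ℂ V _ _ _
      (⨅ p : P, p.1.toSeminormedAddCommGroup.toUniformSpace.toTopologicalSpace) := by
    refine PolynormableSpace.iInf fun p => ?_
    let := p.1.toSeminormedAddCommGroup
    have hw : WithSeminorms (fun _ : Unit => p.1) := by
      rw [SeminormFamily.withSeminorms_iff_topologicalSpace_eq_iInf, iInf_const]
    exact hw.toPolynormableSpace
  rw [← SeminormSpace.topology_eq] at h
  exact h

/-- The identity map from `V` to `SeminormSpace P`. -/
def SeminormSpace.mk : V ≃ₗ[ℂ] SeminormSpace P := LinearEquiv.refl ℂ V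

variable {P}

/-- A seminorm on `V`, seen on `SeminormSpace P`. -/
def SeminormSpace.toSpace (p : Seminorm ℂ V) : Seminorm ℂ (SeminormSpace P) :=
  p.comp (SeminormSpace.mk P).symm.toLinearMap

theorem SeminormSpace.continuous_toSpace {p : Seminorm ℂ V} (hp : p ∈ P) :
    Continuous (SeminormSpace.toSpace (P := P) p) := by
  have h : @Continuous V ℝ
      (⨅ p : P, p.1.toSeminormedAddCommGroup.toUniformSpace.toTopologicalSpace) _ p :=
    continuous_iInf_dom (i := ⟨p, hp⟩) (@continuous_norm _ p.toSeminormedAddCommGroup.toSeminormedAddGroup)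
  rw [← SeminormSpace.topology_eq] at h
  exact h

/-- A set of seminorms which is closed under finite suprema and under multiplication by large
constants. -/
structure Saturated (P : Set (Seminorm ℂ V)) : Prop where
  zero_mem : 0 ∈ P
  sup_mem : ∀ p ∈ P, ∀ q ∈ P, p ⊔ q ∈ P
  smul_mem : ∀ p ∈ P, ∀ C : NNReal, 1 ≤ C → C • p ∈ P

theorem SeminormSpace.exists_le (hP : Saturated P) {s : Seminorm ℂ (SeminormSpace P)}
    (hs : Continuous s) : ∃ p ∈ P, ∀ x : V, s (SeminormSpace.mk P x) ≤ p x := by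
  classical
  have : Nonempty P := ⟨⟨0, hP.zero_mem⟩⟩
  have hw : WithSeminorms (fun p : P => SeminormSpace.toSpace (P := P) p.1) := by
    rw [SeminormFamily.withSeminorms_iff_topologicalSpace_eq_iInf]
    exact SeminormSpace.topology_eq P
  obtain ⟨t, C, -, h⟩ := Seminorm.bound_of_continuous hw s hs
  have key : ∀ t : Finset P, ∃ p ∈ P, (t.sup fun p : P => SeminormSpace.toSpace (P := P) p.1) ≤
      SeminormSpace.toSpace (P := P) p := by
    intro t
    induction t using Finset.induction_on with
    | empty => exact ⟨0, hP.zero_mem, by simp⟩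
    | insert a t _ ih =>
      obtain ⟨p, hp, h⟩ := ih
      refine ⟨a.1 ⊔ p, hP.sup_mem _ a.2 _ hp, ?_⟩
      rw [Finset.sup_insert]
      refine sup_le (fun x => ?_) (h.trans fun x => ?_)
      · exact (le_sup_left : a.1 ≤ a.1 ⊔ p) x
      · exact (le_sup_right : p ≤ a.1 ⊔ p) x
  obtain ⟨p, hp, hpt⟩ := key t
  refine ⟨(C + 1) • p, hP.smul_mem _ hp _ (by simp), fun x => (h _).trans ?_⟩
  have h1 := hpt (SeminormSpace.mk P x)
  change (C : ℝ) * _ ≤ ((C + 1 : NNReal) : ℝ) * p x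
  have h2 : (SeminormSpace.toSpace (P := P) p) (SeminormSpace.mk P x) = p x := rfl
  rw [h2] at h1
  have := apply_nonneg p x
  push_cast
  nlinarith [mul_le_mul_of_nonneg_left h1 C.2]

end SeminormSpace

section Completion

open UniformSpace (Completion)

variable {V : Type*} [AddCommGroup V] [Module ℂ V] (P : Set (Seminorm ℂ V))

instance : ContinuousSMul ℂ (SeminormSpace P) :=
  (PolynormableSpace.withSeminorms ℂ (SeminormSpace P)).continuousSMul

instance : UniformContinuousConstSMul ℂ (SeminormSpace P) :=
  uniformContinuousConstSMul_of_continuousConstSMul ℂ (SeminormSpace P)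

/-- The completion of `V` with respect to the set `P` of seminorms: the completion of the Hausdorff
space associated with `SeminormSpace P`. -/
abbrev SeminormCompletion : Type _ := Completion (SeminormSpace P)

/-- The canonical map from `V` to its completion with respect to `P`. -/
def SeminormCompletion.of : V →ₗ[ℂ] SeminormCompletion P where
  toFun v := ((SeminormSpace.mk P v : SeminormSpace P) : Completion (SeminormSpace P))
  map_add' x y := by rw [map_add, Completion.coe_add]
  map_smul' c x := by rw [map_smul, Completion.coe_smul, RingHom.id_apply]

/-- The canonical continuous linear map from `SeminormSpace P` to its completion. -/
def SeminormCompletion.coeL : SeminormSpace P →L[ℂ] SeminormCompletion P where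
  toFun v := (v : Completion (SeminormSpace P))
  map_add' := Completion.coe_add
  map_smul' := Completion.coe_smul
  cont := Completion.continuous_coe _

variable {P}

theorem SeminormCompletion.denseRange_of : DenseRange (SeminormCompletion.of P) :=
  Completion.denseRange_coe (α := SeminormSpace P)

theorem SeminormCompletion.isUniformInducing_coeL :
    IsUniformInducing (SeminormCompletion.coeL P) :=
  Completion.isUniformInducing_coe _

/-- The extension of a continuous seminorm to the completion. -/
def SeminormCompletion.extendSeminorm (s : Seminorm ℂ (SeminormSpace P)) (hs : Continuous s) :
    Seminorm ℂ (SeminormCompletion P) :=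
  have hu : UniformContinuous s := Seminorm.uniformContinuous_of_continuousAt_zero hs.continuousAt
  have hc : Continuous (Completion.extension s) := Completion.continuous_extension
  have he (a : SeminormSpace P) : Completion.extension s (a : Completion _) = s a :=
    Completion.extension_coe hu a
  Seminorm.of (Completion.extension s)
    (fun x y => by
      refine Completion.induction_on₂ x y (isClosed_le (hc.comp continuous_add)
        ((hc.comp continuous_fst).add (hc.comp continuous_snd))) fun a b => ?_
      rw [← Completion.coe_add, he, he, he]
      exact map_add_le_add s a b)
    (fun c x => by
      refine Completion.induction_on x (isClosed_eq (hc.comp (continuous_const_smul c))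
        (continuous_const.mul hc)) fun a => ?_
      rw [← Completion.coe_smul, he, he]
      exact map_smul_eq_mul s c a)

theorem SeminormCompletion.continuous_extendSeminorm (s : Seminorm ℂ (SeminormSpace P))
    (hs : Continuous s) : Continuous (extendSeminorm s hs) :=
  Completion.continuous_extension (f := s)

theorem SeminormCompletion.extendSeminorm_coe (s : Seminorm ℂ (SeminormSpace P))
    (hs : Continuous s) (a : SeminormSpace P) :
    extendSeminorm s hs (a : Completion (SeminormSpace P)) = s a :=
  Completion.extension_coe (Seminorm.uniformContinuous_of_continuousAt_zero hs.continuousAt) a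

instance : PolynormableSpace ℂ (SeminormCompletion P) where
  withSeminorms' := by
    rw [SeminormFamily.withSeminorms_iff_nhds_eq_iInf]
    refine le_antisymm ?_ ?_
    · simp_rw [le_iInf_iff, ← Filter.tendsto_iff_comap]
      intro ⟨p, hp⟩
      exact hp.tendsto' 0 0 (map_zero _)
    · intro U hU
      obtain ⟨K, hK, hKc, hKU⟩ := exists_mem_nhds_isClosed_subset hU
      have h0 : (fun v : SeminormSpace P => (v : Completion (SeminormSpace P))) ⁻¹' K ∈
          nhds (0 : SeminormSpace P) :=
        (Completion.continuous_coe (SeminormSpace P)).continuousAt.preimage_mem_nhds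
          (by rwa [Completion.coe_zero])
      obtain ⟨V, hV, hVK⟩ :=
        (PolynormableSpace.withSeminorms ℂ (SeminormSpace P)).hasBasis.mem_iff.mp h0
      obtain ⟨t, r, hr, rfl⟩ := (SeminormFamily.basisSets_iff _).mp hV
      set s : Seminorm ℂ (SeminormSpace P) :=
        t.sup fun p : {p : Seminorm ℂ (SeminormSpace P) // Continuous p} => p.1
      have hs : Continuous s := Seminorm.continuous_finsetSup fun i _ => i.2
      refine Filter.mem_of_superset (Filter.mem_iInf_of_mem
        ⟨SeminormCompletion.extendSeminorm s hs, SeminormCompletion.continuous_extendSeminorm s hs⟩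
        (Filter.preimage_mem_comap (Iio_mem_nhds hr))) ?_
      refine subset_trans ?_ hKU
      intro x hx
      have hop : IsOpen (SeminormCompletion.extendSeminorm s hs ⁻¹' Set.Iio r) :=
        isOpen_Iio.preimage (SeminormCompletion.continuous_extendSeminorm s hs)
      rw [← hKc.closure_eq, mem_closure_iff]
      intro O hO hxO
      obtain ⟨a, ha⟩ := (Completion.denseRange_coe (α := SeminormSpace P)).exists_mem_open
        (hO.inter hop) ⟨x, hxO, hx⟩
      refine ⟨a, ha.1, hVK ((Seminorm.mem_ball_zero s).mpr ?_)⟩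
      have := ha.2
      rwa [Set.mem_preimage, SeminormCompletion.extendSeminorm_coe] at this

instance : ContinuousSMul ℂ (SeminormCompletion P) :=
  (PolynormableSpace.withSeminorms ℂ (SeminormCompletion P)).continuousSMul

variable {X : Type*} [AddCommGroup X] [Module ℂ X] [UniformSpace X] [IsUniformAddGroup X]
  [ContinuousSMul ℂ X] [PolynormableSpace ℂ X] [CompleteSpace X] [T0Space X]

/-- The extension of a continuous linear map to the completion. -/
def SeminormCompletion.extendL (f : SeminormSpace P →L[ℂ] X) : SeminormCompletion P →L[ℂ] X :=
  f.extend (SeminormCompletion.coeL P)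

theorem SeminormCompletion.extendL_of (f : SeminormSpace P →L[ℂ] X) (v : V) :
    extendL f (of P v) = f (SeminormSpace.mk P v) :=
  f.extend_eq (e := coeL P) denseRange_of isUniformInducing_coeL (SeminormSpace.mk P v)

theorem SeminormCompletion.ext {f g : SeminormCompletion P →L[ℂ] X}
    (h : ∀ v, f (of P v) = g (of P v)) : f = g :=
  ContinuousLinearMap.coeFn_injective <|
    denseRange_of.equalizer f.continuous g.continuous (funext h)

end Completion

section Bilinear

variable {E F X : Type*}
  [AddCommGroup E] [Module ℂ E] [UniformSpace E] [IsUniformAddGroup E] [ContinuousSMul ℂ E]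
  [PolynormableSpace ℂ E]
  [AddCommGroup F] [Module ℂ F] [UniformSpace F] [IsUniformAddGroup F] [ContinuousSMul ℂ F]
  [PolynormableSpace ℂ F]
  [AddCommGroup X] [Module ℂ X] [UniformSpace X] [IsUniformAddGroup X] [ContinuousSMul ℂ X]
  [PolynormableSpace ℂ X]

theorem exists_seminorm_ball {U : Set E} (hU : U ∈ nhds (0 : E)) :
    ∃ p : Seminorm ℂ E, Continuous p ∧ ∀ x, p x < 1 → x ∈ U := by
  obtain ⟨V, hV, hVU⟩ := (PolynormableSpace.withSeminorms ℂ E).hasBasis.mem_iff.mp hU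
  obtain ⟨t, r, hr, rfl⟩ := (SeminormFamily.basisSets_iff _).mp hV
  set s : Seminorm ℂ E := t.sup fun p : {p : Seminorm ℂ E // Continuous p} => p.1
  have hs : Continuous s := Seminorm.continuous_finsetSup fun i _ => i.2
  refine ⟨r⁻¹.toNNReal • s,
    hs.const_smul r⁻¹.toNNReal, fun x hx => hVU ((Seminorm.mem_ball_zero _).mpr ?_)⟩
  change (r⁻¹.toNNReal : ℝ) * _ < 1 at hx
  rw [Real.coe_toNNReal _ (by positivity)] at hx
  rwa [inv_mul_lt_iff₀ hr, mul_one] at hx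

theorem continuous_of_seminorms (f : E →ₗ[ℂ] X)
    (h : ∀ s : Seminorm ℂ X, Continuous s → ∃ p : Seminorm ℂ E, Continuous p ∧
      ∀ x, s (f x) ≤ p x) : Continuous f := by
  refine (PolynormableSpace.withSeminorms ℂ X).continuous_of_continuous_comp f fun s => ?_
  obtain ⟨p, hp, hle⟩ := h s.1 s.2
  exact Seminorm.continuous_of_le hp hle

/-- Joint continuity of a bilinear map, in terms of seminorms. -/
def JointlyBounded (β : E →ₗ[ℂ] F →ₗ[ℂ] X) : Prop :=
  ∀ s : Seminorm ℂ X, Continuous s → ∃ p : Seminorm ℂ E, Continuous p ∧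
    ∃ q : Seminorm ℂ F, Continuous q ∧ ∀ x y, s (β x y) ≤ p x * q y

theorem JointlyBounded.of_continuous {β : E →ₗ[ℂ] F →ₗ[ℂ] X}
    (h : Continuous fun z : E × F => β z.1 z.2) : JointlyBounded β := by
  intro s hs
  have hU : {z : E × F | s (β z.1 z.2) < 1} ∈ nhds ((0 : E), (0 : F)) := by
    refine ((isOpen_Iio (a := (1 : ℝ))).preimage (hs.comp h)).mem_nhds ?_
    simp
  rw [nhds_prod_eq, Filter.mem_prod_iff] at hU
  obtain ⟨U, hU, W, hW, hUW⟩ := hU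
  obtain ⟨p, hp, hpU⟩ := exists_seminorm_ball hU
  obtain ⟨q, hq, hqW⟩ := exists_seminorm_ball hW
  refine ⟨p, hp, q, hq, fun x y => ?_⟩
  have key : ∀ a b : ℝ, p x < a → q y < b → s (β x y) ≤ a * b := by
    intro a b ha hb
    have ha0 : 0 < a := (apply_nonneg p x).trans_lt ha
    have hb0 : 0 < b := (apply_nonneg q y).trans_lt hb
    have h1 : p (((a⁻¹ : ℝ) : ℂ) • x) < 1 := by
      rw [map_smul_eq_mul, Complex.norm_real, Real.norm_of_nonneg (by positivity)]
      rwa [inv_mul_lt_iff₀ ha0, mul_one]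
    have h2 : q (((b⁻¹ : ℝ) : ℂ) • y) < 1 := by
      rw [map_smul_eq_mul, Complex.norm_real, Real.norm_of_nonneg (by positivity)]
      rwa [inv_mul_lt_iff₀ hb0, mul_one]
    have h3 : s (β (((a⁻¹ : ℝ) : ℂ) • x) (((b⁻¹ : ℝ) : ℂ) • y)) < 1 :=
      hUW (Set.mk_mem_prod (hpU _ h1) (hqW _ h2))
    rw [map_smul (β _), map_smul β, LinearMap.smul_apply, map_smul_eq_mul, map_smul_eq_mul,
      Complex.norm_real, Complex.norm_real, Real.norm_of_nonneg (by positivity),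
      Real.norm_of_nonneg (by positivity), inv_mul_lt_iff₀ hb0, inv_mul_lt_iff₀ ha0] at h3
    linarith
  refine le_of_forall_gt_imp_ge_of_dense ?_ |>.trans le_rfl
  intro c hc
  have ht : Filter.Tendsto (fun e : ℝ => (p x + e) * (q y + e)) (nhdsWithin 0 (Set.Ioi 0))
      (nhds (p x * q y)) := by
    have : Continuous fun e : ℝ => (p x + e) * (q y + e) := by fun_prop
    have := this.tendsto 0
    simp only [add_zero] at this
    exact this.mono_left nhdsWithin_le_nhds
  obtain ⟨e, he, he0⟩ := ((ht.eventually (gt_mem_nhds hc)).and self_mem_nhdsWithin).exists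
  exact (key _ _ (by simpa using he0) (by simpa using he0)).trans he.le

theorem JointlyBounded.continuous {β : E →ₗ[ℂ] F →ₗ[ℂ] X} (h : JointlyBounded β) :
    Continuous fun z : E × F => β z.1 z.2 := by
  rw [continuous_iff_continuousAt]
  rintro ⟨x₀, y₀⟩
  refine ((PolynormableSpace.withSeminorms ℂ X).tendsto_nhds _ _).mpr fun ⟨s, hs⟩ ε hε => ?_
  obtain ⟨p, hp, q, hq, hle⟩ := h s hs
  have ht : Filter.Tendsto (fun z : E × F => p (z.1 - x₀) * q (z.2 - y₀) + p (z.1 - x₀) * q y₀ +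
      p x₀ * q (z.2 - y₀)) (nhds (x₀, y₀)) (nhds 0) := by
    have hc : Continuous (fun z : E × F => p (z.1 - x₀) * q (z.2 - y₀) + p (z.1 - x₀) * q y₀ +
      p x₀ * q (z.2 - y₀)) := by fun_prop
    simpa using hc.tendsto (x₀, y₀)
  filter_upwards [ht.eventually (gt_mem_nhds hε)] with z hz
  refine lt_of_le_of_lt ?_ hz
  have : β z.1 z.2 - β x₀ y₀ =
      β (z.1 - x₀) (z.2 - y₀) + β (z.1 - x₀) y₀ + β x₀ (z.2 - y₀) := by
    simp only [map_sub, LinearMap.sub_apply]; abel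
  change s (β z.1 z.2 - β x₀ y₀) ≤ _
  rw [this]
  exact (map_add_le_add s _ _).trans (add_le_add ((map_add_le_add s _ _).trans
    (add_le_add (hle _ _) (hle _ _))) (hle _ _))

theorem JointlyBounded.flip {β : E →ₗ[ℂ] F →ₗ[ℂ] X} (h : JointlyBounded β) :
    JointlyBounded β.flip := by
  intro s hs
  obtain ⟨p, hp, q, hq, hle⟩ := h s hs
  exact ⟨q, hq, p, hp, fun x y => (hle y x).trans_eq (mul_comm _ _)⟩

end Bilinear
section TensorProduct

variable (E F : Type*)
  [AddCommGroup E] [Module ℂ E] [TopologicalSpace E]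
  [AddCommGroup F] [Module ℂ F] [TopologicalSpace F]

/-- The seminorms defining the projective topology on `E ⊗ F`: those seminorms `r` for which there
are continuous seminorms `p` on `E` and `q` on `F` with `r (x ⊗ y) ≤ p x * q y`. (Equivalently, `r`
is dominated by the projective tensor product of the seminorms `p` and `q`; if `U` and `V` are the
unit balls of `p` and `q`, this says that `r ≤ 1` on the absolutely convex hull of `U ⊗ V`.) -/
def projectiveSeminorms : Set (Seminorm ℂ (E ⊗[ℂ] F)) :=
  {r | ∃ p : Seminorm ℂ E, Continuous p ∧ ∃ q : Seminorm ℂ F, Continuous q ∧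
    ∀ x y, r (x ⊗ₜ[ℂ] y) ≤ p x * q y}

/-- The completed projective tensor product of the locally convex spaces `E` and `F`. -/
def CTensor : Type _ := SeminormCompletion (projectiveSeminorms E F)

namespace CTensor

instance instAddCommGroup : AddCommGroup (CTensor E F) :=
  inferInstanceAs (AddCommGroup (SeminormCompletion (projectiveSeminorms E F)))

instance instModule : Module ℂ (CTensor E F) :=
  inferInstanceAs (Module ℂ (SeminormCompletion (projectiveSeminorms E F)))

instance instUniformSpace : UniformSpace (CTensor E F) :=
  inferInstanceAs (UniformSpace (SeminormCompletion (projectiveSeminorms E F)))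

instance : IsUniformAddGroup (CTensor E F) :=
  inferInstanceAs (IsUniformAddGroup (SeminormCompletion (projectiveSeminorms E F)))

instance : ContinuousSMul ℂ (CTensor E F) :=
  inferInstanceAs (ContinuousSMul ℂ (SeminormCompletion (projectiveSeminorms E F)))

instance : PolynormableSpace ℂ (CTensor E F) :=
  inferInstanceAs (PolynormableSpace ℂ (SeminormCompletion (projectiveSeminorms E F)))

instance : CompleteSpace (CTensor E F) :=
  inferInstanceAs (CompleteSpace (SeminormCompletion (projectiveSeminorms E F)))

instance : T0Space (CTensor E F) :=
  inferInstanceAs (T0Space (SeminormCompletion (projectiveSeminorms E F)))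

/-- The canonical map from the algebraic tensor product to the completed one. -/
def of : E ⊗[ℂ] F →ₗ[ℂ] CTensor E F := SeminormCompletion.of (projectiveSeminorms E F)

theorem denseRange_of : DenseRange (of E F) :=
  SeminormCompletion.denseRange_of (P := projectiveSeminorms E F)

end CTensor

variable {E F}

/-- The elementary tensors in the completed projective tensor product, as a bilinear map. -/
def ctmul : E →ₗ[ℂ] F →ₗ[ℂ] CTensor E F :=
  (TensorProduct.mk ℂ E F).compr₂ (CTensor.of E F)

theorem saturated_projectiveSeminorms : Saturated (projectiveSeminorms E F) where
  zero_mem := ⟨0, continuous_zero, 0, continuous_zero, fun x y => by simp⟩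
  sup_mem := by
    rintro r ⟨p, hp, q, hq, h⟩ r' ⟨p', hp', q', hq', h'⟩
    refine ⟨p ⊔ p', hp.sup hp', q ⊔ q', hq.sup hq', fun x y => ?_⟩
    refine sup_le ((h x y).trans ?_) ((h' x y).trans ?_)
    · exact mul_le_mul le_sup_left le_sup_left (apply_nonneg _ _)
        ((apply_nonneg p x).trans le_sup_left)
    · exact mul_le_mul le_sup_right le_sup_right (apply_nonneg _ _)
        ((apply_nonneg p x).trans le_sup_left)
  smul_mem := by
    rintro r ⟨p, hp, q, hq, h⟩ C -
    refine ⟨C • p, hp.const_smul C, q, hq, fun x y => ?_⟩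
    change (C : ℝ) * _ ≤ (C : ℝ) * _ * _
    rw [mul_assoc]
    exact mul_le_mul_of_nonneg_left (h x y) C.2

end TensorProduct

section Lift

variable {E F K X : Type*}
  [AddCommGroup E] [Module ℂ E] [UniformSpace E] [IsUniformAddGroup E] [ContinuousSMul ℂ E]
  [PolynormableSpace ℂ E]
  [AddCommGroup F] [Module ℂ F] [UniformSpace F] [IsUniformAddGroup F] [ContinuousSMul ℂ F]
  [PolynormableSpace ℂ F]
  [AddCommGroup K] [Module ℂ K] [UniformSpace K] [IsUniformAddGroup K] [ContinuousSMul ℂ K]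
  [PolynormableSpace ℂ K]
  [AddCommGroup X] [Module ℂ X] [UniformSpace X] [IsUniformAddGroup X] [ContinuousSMul ℂ X]
  [PolynormableSpace ℂ X]

/-- The projective tensor product of two seminorms: the largest seminorm `r` with
`r (x ⊗ y) ≤ p x * q y`. -/
def projSeminorm {E F : Type*} [AddCommGroup E] [Module ℂ E] [AddCommGroup F] [Module ℂ F]
    (p : Seminorm ℂ E) (q : Seminorm ℂ F) : Seminorm ℂ (E ⊗[ℂ] F) :=
  sSup {r | ∀ x y, r (x ⊗ₜ[ℂ] y) ≤ p x * q y}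

theorem bddAbove_projSeminorm {E F : Type*} [AddCommGroup E] [Module ℂ E] [AddCommGroup F]
    [Module ℂ F] (p : Seminorm ℂ E) (q : Seminorm ℂ F) :
    BddAbove {r : Seminorm ℂ (E ⊗[ℂ] F) | ∀ x y, r (x ⊗ₜ[ℂ] y) ≤ p x * q y} := by
  rw [Seminorm.bddAbove_iff]
  have key : ∀ t : E ⊗[ℂ] F, ∃ C : ℝ, ∀ r : Seminorm ℂ (E ⊗[ℂ] F),
      (∀ x y, r (x ⊗ₜ[ℂ] y) ≤ p x * q y) → r t ≤ C := by
    intro t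
    induction t using TensorProduct.induction_on with
    | zero => exact ⟨0, fun r _ => by simp⟩
    | tmul x y => exact ⟨p x * q y, fun r h => h x y⟩
    | add a b ha hb =>
      obtain ⟨C, hC⟩ := ha
      obtain ⟨D, hD⟩ := hb
      exact ⟨C + D, fun r h => (map_add_le_add r a b).trans (add_le_add (hC r h) (hD r h))⟩
  choose C hC using key
  refine ⟨C, ?_⟩
  rintro _ ⟨r, hr, rfl⟩ t
  exact hC t r hr

theorem le_projSeminorm {E F : Type*} [AddCommGroup E] [Module ℂ E] [AddCommGroup F]
    [Module ℂ F] {p : Seminorm ℂ E} {q : Seminorm ℂ F} {r : Seminorm ℂ (E ⊗[ℂ] F)}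
    (h : ∀ x y, r (x ⊗ₜ[ℂ] y) ≤ p x * q y) : r ≤ projSeminorm p q :=
  le_csSup (bddAbove_projSeminorm p q) h

theorem projSeminorm_tmul_le {E F : Type*} [AddCommGroup E] [Module ℂ E] [AddCommGroup F]
    [Module ℂ F] (p : Seminorm ℂ E) (q : Seminorm ℂ F) (x : E) (y : F) :
    projSeminorm p q (x ⊗ₜ[ℂ] y) ≤ p x * q y := by
  rw [projSeminorm, Seminorm.sSup_apply (bddAbove_projSeminorm p q)]
  have : Nonempty {r : Seminorm ℂ (E ⊗[ℂ] F) | ∀ x y, r (x ⊗ₜ[ℂ] y) ≤ p x * q y} :=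
    ⟨⟨0, fun x y => mul_nonneg (apply_nonneg p x) (apply_nonneg q y)⟩⟩
  exact ciSup_le fun r => r.2 x y

theorem le_mul_projSeminorm {E F : Type*} [AddCommGroup E] [Module ℂ E] [AddCommGroup F]
    [Module ℂ F] {p : Seminorm ℂ E} {q : Seminorm ℂ F} {r : Seminorm ℂ (E ⊗[ℂ] F)} {c : ℝ}
    (hc : 0 ≤ c) (h : ∀ x y, r (x ⊗ₜ[ℂ] y) ≤ c * (p x * q y)) (t : E ⊗[ℂ] F) :
    r t ≤ c * projSeminorm p q t := by
  rcases hc.eq_or_lt with rfl | hc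
  · rw [zero_mul]
    induction t using TensorProduct.induction_on with
    | zero => simp
    | tmul x y => simpa using h x y
    | add a b ha hb => exact (map_add_le_add r a b).trans (by linarith)
  · have h1 : c⁻¹.toNNReal • r ≤ projSeminorm p q := le_projSeminorm fun x y => by
      change (c⁻¹.toNNReal : ℝ) * _ ≤ _
      rw [Real.coe_toNNReal _ (by positivity), inv_mul_le_iff₀ hc]
      exact h x y
    have h2 := h1 t
    change (c⁻¹.toNNReal : ℝ) * _ ≤ _ at h2
    rwa [Real.coe_toNNReal _ (by positivity), inv_mul_le_iff₀ hc] at h2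

theorem jointlyBounded_ctmul : JointlyBounded (ctmul : E →ₗ[ℂ] F →ₗ[ℂ] CTensor E F) := by
  intro s hs
  obtain ⟨r, ⟨p, hp, q, hq, h⟩, hle⟩ :=
    SeminormSpace.exists_le saturated_projectiveSeminorms
      (s := s.comp (SeminormCompletion.coeL (projectiveSeminorms E F)).toLinearMap)
      (hs.comp (SeminormCompletion.coeL (projectiveSeminorms E F)).continuous)
  exact ⟨p, hp, q, hq, fun x y => (hle (x ⊗ₜ[ℂ] y)).trans (h x y)⟩

variable [CompleteSpace X] [T0Space X]

/-- The continuous linear map on the completed projective tensor product defined by a jointly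
continuous bilinear map into a complete space. -/
def clift (β : E →ₗ[ℂ] F →ₗ[ℂ] X) (h : JointlyBounded β) : CTensor E F →L[ℂ] X :=
  SeminormCompletion.extendL (P := projectiveSeminorms E F)
    { toLinearMap := (TensorProduct.lift β) ∘ₗ
        (SeminormSpace.mk (projectiveSeminorms E F)).symm.toLinearMap
      cont := continuous_of_seminorms _ fun s hs => by
        obtain ⟨p, hp, q, hq, hle⟩ := h s hs
        refine ⟨SeminormSpace.toSpace (s.comp (TensorProduct.lift β)),
          SeminormSpace.continuous_toSpace ⟨p, hp, q, hq, fun x y => ?_⟩, fun x => le_rfl⟩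
        simpa using hle x y }

@[simp]
theorem clift_ctmul (β : E →ₗ[ℂ] F →ₗ[ℂ] X) (h : JointlyBounded β) (x : E) (y : F) :
    clift β h (ctmul x y) = β x y :=
  (SeminormCompletion.extendL_of _ (x ⊗ₜ[ℂ] y)).trans (TensorProduct.lift.tmul x y)

theorem ctensor_ext {f g : CTensor E F →L[ℂ] X} (h : ∀ x y, f (ctmul x y) = g (ctmul x y)) :
    f = g := by
  refine SeminormCompletion.ext (P := projectiveSeminorms E F) fun t => ?_
  change f (CTensor.of E F t) = g (CTensor.of E F t)
  induction t using TensorProduct.induction_on with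
  | zero => simp
  | tmul x y => exact h x y
  | add a b ha hb => simp [ha, hb]

/-- Extension of a jointly continuous bilinear map on `V × F`, where `V` carries the topology
generated by `P`, to the completion of `V` in the first variable. -/
def extendLeft {V : Type*} [AddCommGroup V] [Module ℂ V] {P : Set (Seminorm ℂ V)}
    (β : SeminormSpace P →ₗ[ℂ] F →ₗ[ℂ] X) (h : JointlyBounded β) :
    SeminormCompletion P →ₗ[ℂ] F →ₗ[ℂ] X :=
  have hc (y : F) : Continuous (β.flip y) := by
    have := h.continuous
    exact this.comp (Continuous.prodMk_left y)
  LinearMap.flip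
    { toFun := fun y =>
        (SeminormCompletion.extendL ⟨β.flip y, hc y⟩ : SeminormCompletion P →L[ℂ] X).toLinearMap
      map_add' := fun y z => by
        rw [← ContinuousLinearMap.toLinearMap_add]
        congr 1
        refine SeminormCompletion.ext fun v => ?_
        simp [SeminormCompletion.extendL_of]
      map_smul' := fun c y => by
        rw [RingHom.id_apply, ← ContinuousLinearMap.toLinearMap_smul]
        congr 1
        refine SeminormCompletion.ext fun v => ?_
        simp [SeminormCompletion.extendL_of] }

theorem extendLeft_of {V : Type*} [AddCommGroup V] [Module ℂ V] {P : Set (Seminorm ℂ V)}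
    (β : SeminormSpace P →ₗ[ℂ] F →ₗ[ℂ] X) (h : JointlyBounded β) (v : V) (y : F) :
    extendLeft β h (SeminormCompletion.of P v) y = β (SeminormSpace.mk P v) y :=
  SeminormCompletion.extendL_of _ v

theorem continuous_extendLeft {V : Type*} [AddCommGroup V] [Module ℂ V]
    {P : Set (Seminorm ℂ V)}
    (β : SeminormSpace P →ₗ[ℂ] F →ₗ[ℂ] X) (h : JointlyBounded β) (y : F) :
    Continuous fun z => extendLeft β h z y :=
  ContinuousLinearMap.continuous
    (SeminormCompletion.extendL ⟨β.flip y, h.continuous.comp (Continuous.prodMk_left y)⟩ :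
      SeminormCompletion P →L[ℂ] X)

theorem jointlyBounded_extendLeft {V : Type*} [AddCommGroup V] [Module ℂ V]
    {P : Set (Seminorm ℂ V)} (β : SeminormSpace P →ₗ[ℂ] F →ₗ[ℂ] X) (h : JointlyBounded β) :
    JointlyBounded (extendLeft β h) := by
  intro s hs
  obtain ⟨p, hp, q, hq, hle⟩ := h s hs
  refine ⟨SeminormCompletion.extendSeminorm p hp,
    SeminormCompletion.continuous_extendSeminorm p hp, q, hq, fun x y => ?_⟩
  refine SeminormCompletion.denseRange_of.induction_on
    (p := fun x => s (extendLeft β h x y) ≤ SeminormCompletion.extendSeminorm p hp x * q y) x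
    (isClosed_le (hs.comp (continuous_extendLeft β h y))
      ((SeminormCompletion.continuous_extendSeminorm p hp).mul continuous_const)) fun v => ?_
  rw [extendLeft_of]
  refine (hle _ _).trans_eq ?_
  congr 1
  exact (SeminormCompletion.extendSeminorm_coe p hp (SeminormSpace.mk P v)).symm

variable (E F K) in
/-- The trilinear map `(x, y, z) ↦ x ⊗ (y ⊗ z)`, as a bilinear map on `(E ⊗ F) × K`. -/
def assocAux : SeminormSpace (projectiveSeminorms E F) →ₗ[ℂ] K →ₗ[ℂ] CTensor E (CTensor F K) :=
  (TensorProduct.lift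
    { toFun := fun x => (ctmul : F →ₗ[ℂ] K →ₗ[ℂ] CTensor F K).compr₂ (ctmul x)
      map_add' := fun x y => by ext; simp
      map_smul' := fun c x => by ext; simp }) ∘ₗ
  (SeminormSpace.mk (projectiveSeminorms E F)).symm.toLinearMap

theorem jointlyBounded_assocAux : JointlyBounded (assocAux E F K) := by
  intro s hs
  obtain ⟨p, hp, q', hq', h⟩ := jointlyBounded_ctmul (E := E) (F := CTensor F K) s hs
  obtain ⟨q, hq, r, hr, h'⟩ := jointlyBounded_ctmul (E := F) (F := K) q' hq'
  refine ⟨SeminormSpace.toSpace (projSeminorm p q),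
    SeminormSpace.continuous_toSpace ⟨p, hp, q, hq, projSeminorm_tmul_le p q⟩, r, hr,
    fun t z => ?_⟩
  have := le_mul_projSeminorm (p := p) (q := q)
    (r := s.comp ((assocAux E F K).flip z ∘ₗ
      (SeminormSpace.mk (projectiveSeminorms E F)).toLinearMap)) (apply_nonneg r z)
    (fun x y => by
      have h1 := h x (ctmul y z)
      have h2 := mul_le_mul_of_nonneg_left (h' y z) (apply_nonneg p x)
      refine (h1.trans h2).trans_eq ?_
      ring) ((SeminormSpace.mk (projectiveSeminorms E F)).symm t)
  exact this.trans_eq (mul_comm _ _)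

variable (E F K) in
/-- The bilinear map `(x ⊗ y, z) ↦ x ⊗ (y ⊗ z)` on completed projective tensor products. -/
def assocBilin : CTensor E F →ₗ[ℂ] K →ₗ[ℂ] CTensor E (CTensor F K) :=
  extendLeft (assocAux E F K) jointlyBounded_assocAux

theorem jointlyBounded_assocBilin : JointlyBounded (assocBilin E F K) :=
  jointlyBounded_extendLeft (assocAux E F K) jointlyBounded_assocAux

theorem assocBilin_ctmul (x : E) (y : F) (z : K) :
    assocBilin E F K (ctmul x y) z = ctmul x (ctmul y z) :=
  extendLeft_of _ _ (x ⊗ₜ[ℂ] y) z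

theorem ctensor_mem_of_isClosed {M : Submodule ℂ (CTensor E F)}
    (hM : IsClosed (M : Set (CTensor E F))) (h : ∀ x y, ctmul x y ∈ M) (z : CTensor E F) :
    z ∈ M := by
  refine (CTensor.denseRange_of E F).induction_on (p := fun z => z ∈ M) z hM fun t => ?_
  induction t using TensorProduct.induction_on with
  | zero => simp
  | tmul x y => exact h x y
  | add a b ha hb => rw [map_add]; exact M.add_mem ha hb

attribute [irreducible] CTensor CTensor.instAddCommGroup CTensor.instModule
  CTensor.instUniformSpace

end Lift
section Functoriality

variable {E F K E' F' : Type*}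
  [AddCommGroup E] [Module ℂ E] [UniformSpace E] [IsUniformAddGroup E] [ContinuousSMul ℂ E]
  [PolynormableSpace ℂ E]
  [AddCommGroup F] [Module ℂ F] [UniformSpace F] [IsUniformAddGroup F] [ContinuousSMul ℂ F]
  [PolynormableSpace ℂ F]
  [AddCommGroup K] [Module ℂ K] [UniformSpace K] [IsUniformAddGroup K] [ContinuousSMul ℂ K]
  [PolynormableSpace ℂ K]
  [AddCommGroup E'] [Module ℂ E'] [UniformSpace E'] [IsUniformAddGroup E'] [ContinuousSMul ℂ E']
  [PolynormableSpace ℂ E']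
  [AddCommGroup F'] [Module ℂ F'] [UniformSpace F'] [IsUniformAddGroup F'] [ContinuousSMul ℂ F']
  [PolynormableSpace ℂ F']

theorem JointlyBounded.compl₁₂ {X : Type*} [AddCommGroup X] [Module ℂ X] [UniformSpace X]
    {β : E' →ₗ[ℂ] F' →ₗ[ℂ] X} (h : JointlyBounded β) (f : E →L[ℂ] E') (g : F →L[ℂ] F') :
    JointlyBounded (β.compl₁₂ f.toLinearMap g.toLinearMap) := by
  intro s hs
  obtain ⟨p, hp, q, hq, hle⟩ := h s hs
  exact ⟨p.comp f.toLinearMap, hp.comp f.continuous, q.comp g.toLinearMap, hq.comp g.continuous,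
    fun x y => hle (f x) (g y)⟩

/-- The completed projective tensor product of two continuous linear maps. -/
def cmap (f : E →L[ℂ] E') (g : F →L[ℂ] F') : CTensor E F →L[ℂ] CTensor E' F' :=
  clift (ctmul.compl₁₂ f.toLinearMap g.toLinearMap) (jointlyBounded_ctmul.compl₁₂ f g)

@[simp]
theorem cmap_ctmul (f : E →L[ℂ] E') (g : F →L[ℂ] F') (x : E) (y : F) :
    cmap f g (ctmul x y) = ctmul (f x) (g y) :=
  clift_ctmul _ _ x y

variable (E F) in
/-- The flip `x ⊗ y ↦ y ⊗ x` on completed projective tensor products. -/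
def ccomm : CTensor E F →L[ℂ] CTensor F E :=
  clift (ctmul : F →ₗ[ℂ] E →ₗ[ℂ] CTensor F E).flip jointlyBounded_ctmul.flip

@[simp]
theorem ccomm_ctmul (x : E) (y : F) : ccomm E F (ctmul x y) = ctmul y x :=
  clift_ctmul _ _ x y

variable (E F K) in
/-- The map `(x ⊗ y) ⊗ z ↦ x ⊗ (y ⊗ z)` on completed projective tensor products. -/
def cassocHom : CTensor (CTensor E F) K →L[ℂ] CTensor E (CTensor F K) :=
  clift (assocBilin E F K) jointlyBounded_assocBilin

@[simp]
theorem cassocHom_ctmul (x : E) (y : F) (z : K) :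
    cassocHom E F K (ctmul (ctmul x y) z) = ctmul x (ctmul y z) := by
  rw [cassocHom, clift_ctmul, assocBilin_ctmul]

variable (E F K) in
/-- The map `x ⊗ (y ⊗ z) ↦ (x ⊗ y) ⊗ z` on completed projective tensor products. -/
def cassocInv : CTensor E (CTensor F K) →L[ℂ] CTensor (CTensor E F) K :=
  cmap (ccomm F E) (.id ℂ K) ∘L ccomm K (CTensor F E) ∘L cassocHom K F E ∘L
    cmap (ccomm F K) (.id ℂ E) ∘L ccomm E (CTensor F K)

@[simp]
theorem cassocInv_ctmul (x : E) (y : F) (z : K) :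
    cassocInv E F K (ctmul x (ctmul y z)) = ctmul (ctmul x y) z := by
  simp [cassocInv]

theorem continuous_ctmul : Continuous fun z : E × F => ctmul z.1 z.2 :=
  jointlyBounded_ctmul.continuous

theorem continuous_ctmul_left (y : F) :
    Continuous ((ctmul : E →ₗ[ℂ] F →ₗ[ℂ] CTensor E F).flip y) :=
  continuous_ctmul.comp (Continuous.prodMk_left y)

theorem continuous_ctmul_right (x : E) :
    Continuous fun y : F => (ctmul x y : CTensor E F) := by
  have h : Continuous ((fun z : E × F => (ctmul z.1 z.2 : CTensor E F)) ∘ fun y => (x, y)) :=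
    continuous_ctmul.comp (Continuous.prodMk_right x)
  simpa only [Function.comp_def] using h

/-- The map `x ↦ x ⊗ y`, as a continuous linear map. -/
def ctmulLeft (y : F) : E →L[ℂ] CTensor E F := ⟨ctmul.flip y, continuous_ctmul_left y⟩

/-- The map `y ↦ x ⊗ y`, as a continuous linear map. -/
def ctmulRight (x : E) : F →L[ℂ] CTensor E F := ⟨ctmul x, continuous_ctmul_right x⟩

variable (E F K) in
/-- The associativity isomorphism `(x ⊗ y) ⊗ z ↦ x ⊗ (y ⊗ z)` of completed projective tensor
products. -/
def cassoc : CTensor (CTensor E F) K ≃L[ℂ] CTensor E (CTensor F K) :=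
  ContinuousLinearEquiv.equivOfInverse (cassocHom E F K) (cassocInv E F K)
    (fun t => by
      have h : cassocInv E F K ∘L cassocHom E F K = .id ℂ _ := ctensor_ext fun u z => by
        have h : cassocInv E F K ∘L cassocHom E F K ∘L ctmulLeft z = ctmulLeft z :=
          ctensor_ext fun x y => by
            change cassocInv E F K (cassocHom E F K (ctmul (ctmul x y) z)) = ctmul (ctmul x y) z
            simp
        exact DFunLike.congr_fun h u
      exact DFunLike.congr_fun h t)
    (fun t => by
      have h : cassocHom E F K ∘L cassocInv E F K = .id ℂ _ := ctensor_ext fun x u => by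
        have h : cassocHom E F K ∘L cassocInv E F K ∘L ctmulRight x = ctmulRight x :=
          ctensor_ext fun y z => by
            change cassocHom E F K (cassocInv E F K (ctmul x (ctmul y z))) = ctmul x (ctmul y z)
            simp
        exact DFunLike.congr_fun h u
      exact DFunLike.congr_fun h t)

@[simp]
theorem cassoc_ctmul (x : E) (y : F) (z : K) :
    cassoc E F K (ctmul (ctmul x y) z) = ctmul x (ctmul y z) :=
  cassocHom_ctmul x y z

@[simp]
theorem cassoc_symm_ctmul (x : E) (y : F) (z : K) :
    (cassoc E F K).symm (ctmul x (ctmul y z)) = ctmul (ctmul x y) z :=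
  cassocInv_ctmul x y z

end Functoriality

section Smash

/-! The multiplication of the smash product, algebraically and analytically. -/

/-- The map `τ : H ⊗ A → A ⊗ H` given by `h ⊗ a ↦ ∑ (h₁ · a) ⊗ h₂`, where `act : H ⊗ A → A` is the
action. -/
def tau {H A : Type*} [AddCommGroup H] [Module ℂ H] [AddCommGroup A] [Module ℂ A]
    (comul : H →ₗ[ℂ] H ⊗[ℂ] H) (act : H ⊗[ℂ] A →ₗ[ℂ] A) : H ⊗[ℂ] A →ₗ[ℂ] A ⊗[ℂ] H :=
  TensorProduct.map act .id ∘ₗ (TensorProduct.assoc ℂ H A H).symm.toLinearMap ∘ₗ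
    TensorProduct.map .id (TensorProduct.comm ℂ H A).toLinearMap ∘ₗ
    (TensorProduct.assoc ℂ H H A).toLinearMap ∘ₗ TensorProduct.map comul .id

/-- The multiplication `(μ_A ⊗ μ_H) (1 ⊗ τ ⊗ 1)` of the smash product. -/
def smashMul {H A : Type*} [AddCommGroup H] [Module ℂ H] [AddCommGroup A] [Module ℂ A]
    (mulA : A ⊗[ℂ] A →ₗ[ℂ] A) (mulH : H ⊗[ℂ] H →ₗ[ℂ] H) (t : H ⊗[ℂ] A →ₗ[ℂ] A ⊗[ℂ] H) :
    (A ⊗[ℂ] H) ⊗[ℂ] (A ⊗[ℂ] H) →ₗ[ℂ] A ⊗[ℂ] H :=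
  TensorProduct.map mulA mulH ∘ₗ
    (TensorProduct.assoc ℂ A A (H ⊗[ℂ] H)).symm.toLinearMap ∘ₗ
    TensorProduct.map .id (TensorProduct.assoc ℂ A H H).toLinearMap ∘ₗ
    TensorProduct.map .id (TensorProduct.map t .id) ∘ₗ
    TensorProduct.map .id (TensorProduct.assoc ℂ H A H).symm.toLinearMap ∘ₗ
    (TensorProduct.assoc ℂ A H (A ⊗[ℂ] H)).toLinearMap

variable {H A : Type*}
  [AddCommGroup H] [Module ℂ H] [UniformSpace H] [IsUniformAddGroup H] [ContinuousSMul ℂ H]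
  [PolynormableSpace ℂ H]
  [AddCommGroup A] [Module ℂ A] [UniformSpace A] [IsUniformAddGroup A] [ContinuousSMul ℂ A]
  [PolynormableSpace ℂ A] [CompleteSpace A] [T0Space A]

/-- The analogue of `tau` for completed projective tensor products. -/
def ctau (comul : H →L[ℂ] CTensor H H) (act : CTensor H A →L[ℂ] A) :
    CTensor H A →L[ℂ] CTensor A H :=
  cmap act (.id ℂ H) ∘L (cassoc H A H).symm.toContinuousLinearMap ∘L cmap (.id ℂ H) (ccomm H A) ∘L
    (cassoc H H A).toContinuousLinearMap ∘L cmap comul (.id ℂ A)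

/-- The analogue of `smashMul` for completed projective tensor products. -/
def csmashMul (mulA : CTensor A A →L[ℂ] A) (mulH : CTensor H H →L[ℂ] H)
    (t : CTensor H A →L[ℂ] CTensor A H) :
    CTensor (CTensor A H) (CTensor A H) →L[ℂ] CTensor A H :=
  cmap mulA mulH ∘L (cassoc A A (CTensor H H)).symm.toContinuousLinearMap ∘L
    cmap (.id ℂ A) (cassoc A H H).toContinuousLinearMap ∘L cmap (.id ℂ A) (cmap t (.id ℂ H)) ∘L
    cmap (.id ℂ A) (cassoc H A H).symm.toContinuousLinearMap ∘L
    (cassoc A H (CTensor A H)).toContinuousLinearMap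

theorem exists_ctau (comul : H →L[ℂ] CTensor H H) (act : CTensor H A →L[ℂ] A) :
    ∃ L : CTensor (CTensor H H) A →ₗ[ℂ] CTensor A H,
      (∀ h a, ctau comul act (ctmul h a) = L (ctmul (comul h) a)) ∧
      ∀ x y a, L (ctmul (ctmul x y) a) = ctmul (act (ctmul x a)) y :=
  ⟨(cmap act (.id ℂ H) ∘L (cassoc H A H).symm.toContinuousLinearMap ∘L
    cmap (.id ℂ H) (ccomm H A) ∘L (cassoc H H A).toContinuousLinearMap).toLinearMap,
    fun h a => by simp [ctau], fun x y a => by simp⟩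

theorem exists_csmashMul (mulA : CTensor A A →L[ℂ] A) (mulH : CTensor H H →L[ℂ] H)
    (t : CTensor H A →L[ℂ] CTensor A H) :
    ∃ L : CTensor A (CTensor (CTensor A H) H) →ₗ[ℂ] CTensor A H,
      (∀ a h b k, csmashMul mulA mulH t (ctmul (ctmul a h) (ctmul b k)) =
        L (ctmul a (ctmul (t (ctmul h b)) k))) ∧
      ∀ a c l k, L (ctmul a (ctmul (ctmul c l) k)) =
        ctmul (mulA (ctmul a c)) (mulH (ctmul l k)) :=
  ⟨(cmap mulA mulH ∘L (cassoc A A (CTensor H H)).symm.toContinuousLinearMap ∘L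
    cmap (.id ℂ A) (cassoc A H H).toContinuousLinearMap).toLinearMap,
    fun a h b k => by simp [csmashMul], fun a c l k => by simp⟩

/-- The linear map `V ⊗ W → E ⊗̂ F` defined by linear maps `i : V → E` and `j : W → F`. -/
def ctensorMap {V W E F : Type*} [AddCommGroup V] [Module ℂ V] [AddCommGroup W] [Module ℂ W]
    [AddCommGroup E] [Module ℂ E] [TopologicalSpace E] [AddCommGroup F] [Module ℂ F]
    [TopologicalSpace F] (i : V →ₗ[ℂ] E) (j : W →ₗ[ℂ] F) : V ⊗[ℂ] W →ₗ[ℂ] CTensor E F :=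
  TensorProduct.lift (ctmul.compl₁₂ i j)

@[simp]
theorem ctensorMap_tmul {V W E F : Type*} [AddCommGroup V] [Module ℂ V] [AddCommGroup W]
    [Module ℂ W] [AddCommGroup E] [Module ℂ E] [TopologicalSpace E] [AddCommGroup F] [Module ℂ F]
    [TopologicalSpace F] (i : V →ₗ[ℂ] E) (j : W →ₗ[ℂ] F) (v : V) (w : W) :
    ctensorMap i j (v ⊗ₜ[ℂ] w) = ctmul (i v) (j w) := by
  simp [ctensorMap]

variable {H₀ A₀ : Type*} [AddCommGroup H₀] [Module ℂ H₀] [AddCommGroup A₀] [Module ℂ A₀]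

theorem ctau_compat (i : A₀ →ₗ[ℂ] A) (j : H₀ →ₗ[ℂ] H) (comul₀ : H₀ →ₗ[ℂ] H₀ ⊗[ℂ] H₀)
    (act₀ : H₀ ⊗[ℂ] A₀ →ₗ[ℂ] A₀) (comul : H →L[ℂ] CTensor H H) (act : CTensor H A →L[ℂ] A)
    (hc : ∀ h, comul (j h) = ctensorMap j j (comul₀ h))
    (ha : ∀ h a, act (ctmul (j h) (i a)) = i (act₀ (h ⊗ₜ[ℂ] a))) (h : H₀) (a : A₀) :
    ctau comul act (ctmul (j h) (i a)) = ctensorMap i j (tau comul₀ act₀ (h ⊗ₜ[ℂ] a)) := by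
  obtain ⟨L, hL, hL'⟩ := exists_ctau comul act
  rw [hL, hc]
  simp only [tau, LinearMap.comp_apply, TensorProduct.map_tmul]
  generalize comul₀ h = t
  induction t using TensorProduct.induction_on with
  | zero => simp
  | add u v hu hv =>
    simp only [map_add, LinearMap.add_apply, TensorProduct.add_tmul] at hu hv ⊢
    rw [hu, hv]
  | tmul x y =>
    rw [ctensorMap_tmul, hL', ha]
    simp

theorem csmashMul_compat (i : A₀ →ₗ[ℂ] A) (j : H₀ →ₗ[ℂ] H) (mulA₀ : A₀ ⊗[ℂ] A₀ →ₗ[ℂ] A₀)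
    (mulH₀ : H₀ ⊗[ℂ] H₀ →ₗ[ℂ] H₀) (t₀ : H₀ ⊗[ℂ] A₀ →ₗ[ℂ] A₀ ⊗[ℂ] H₀)
    (mulA : CTensor A A →L[ℂ] A) (mulH : CTensor H H →L[ℂ] H)
    (t : CTensor H A →L[ℂ] CTensor A H)
    (hA : ∀ a b, mulA (ctmul (i a) (i b)) = i (mulA₀ (a ⊗ₜ[ℂ] b)))
    (hH : ∀ a b, mulH (ctmul (j a) (j b)) = j (mulH₀ (a ⊗ₜ[ℂ] b)))
    (ht : ∀ h a, t (ctmul (j h) (i a)) = ctensorMap i j (t₀ (h ⊗ₜ[ℂ] a)))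
    (x y : A₀ ⊗[ℂ] H₀) :
    csmashMul mulA mulH t (ctmul (ctensorMap i j x) (ctensorMap i j y)) =
      ctensorMap i j (smashMul mulA₀ mulH₀ t₀ (x ⊗ₜ[ℂ] y)) := by
  have key (L : CTensor A (CTensor (CTensor A H) H) →ₗ[ℂ] CTensor A H)
      (hL : ∀ a c l k, L (ctmul a (ctmul (ctmul c l) k)) =
        ctmul (mulA (ctmul a c)) (mulH (ctmul l k))) {a : A₀} {k : H₀} (w : A₀ ⊗[ℂ] H₀) :
      L (ctmul (i a) (ctmul (ctensorMap i j w) (j k))) =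
        ctensorMap i j (TensorProduct.map mulA₀ mulH₀ ((TensorProduct.assoc ℂ A₀ A₀ _).symm
          (a ⊗ₜ[ℂ] (TensorProduct.assoc ℂ A₀ H₀ H₀ (w ⊗ₜ[ℂ] k))))) := by
    induction w using TensorProduct.induction_on with
    | zero => simp
    | add u v hu hv =>
      simp only [map_add, LinearMap.add_apply, TensorProduct.add_tmul, TensorProduct.tmul_add]
        at hu hv ⊢
      rw [hu, hv]
    | tmul c l =>
      rw [ctensorMap_tmul, hL, hA, hH]
      simp
  induction x using TensorProduct.induction_on with
  | zero => simp
  | add u v hu hv =>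
    simp only [map_add, LinearMap.add_apply, TensorProduct.add_tmul, hu, hv]
  | tmul a h =>
    induction y using TensorProduct.induction_on with
    | zero => simp
    | add u v hu hv => simp only [map_add, TensorProduct.tmul_add, hu, hv]
    | tmul b k =>
      obtain ⟨L, hL, hL'⟩ := exists_csmashMul mulA mulH t
      have e1 := ctensorMap_tmul i j a h
      have e2 := ctensorMap_tmul i j b k
      rw [e1, e2, hL (i a) (j h) (i b) (j k), ht]
      simp only [smashMul, LinearMap.comp_apply, LinearEquiv.coe_coe,
        TensorProduct.assoc_tmul, TensorProduct.map_tmul, TensorProduct.assoc_symm_tmul,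
        LinearMap.id_apply]
      exact key L hL' _

end Smash
section Algebras

open UniformSpace (Completion)

/-- The set of all submultiplicative seminorms on an algebra. -/
def submultSeminorms (B : Type*) [Ring B] [Algebra ℂ B] : Set (Seminorm ℂ B) :=
  {p | ∀ a b, p (a * b) ≤ p a * p b}

/-- A set of seminorms on an algebra all of which are submultiplicative. -/
class IsSubmultiplicative {B : Type*} [Ring B] [Algebra ℂ B] (P : Set (Seminorm ℂ B)) : Prop where
  subset : P ⊆ submultSeminorms B

section

variable {B : Type*} [Ring B] [Algebra ℂ B] (P : Set (Seminorm ℂ B))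

instance : Ring (SeminormSpace P) := inferInstanceAs (Ring B)

instance : Algebra ℂ (SeminormSpace P) := inferInstanceAs (Algebra ℂ B)

instance [hP : IsSubmultiplicative P] : IsTopologicalRing (SeminormSpace P) where
  continuous_mul := by
    rcases P.eq_empty_or_nonempty with rfl | hne
    · have : (UniformSpace.toTopologicalSpace : TopologicalSpace (SeminormSpace (∅ : Set (Seminorm ℂ B)))) = ⊤ :=
        (SeminormSpace.topology_eq _).trans (iInf_of_empty _)
      rw [continuous_def]
      intro s hs
      rw [this, TopologicalSpace.isOpen_top_iff] at hs
      rcases hs with rfl | rfl <;> simp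
    · have : Nonempty P := hne.to_subtype
      have hw : WithSeminorms (fun p : P => SeminormSpace.toSpace (P := P) p.1) := by
        rw [SeminormFamily.withSeminorms_iff_topologicalSpace_eq_iInf]
        exact SeminormSpace.topology_eq P
      rw [continuous_iff_continuousAt]
      rintro ⟨x₀, y₀⟩
      refine (hw.tendsto_nhds _ _).mpr fun i ε hε => ?_
      have hp : Continuous (SeminormSpace.toSpace (P := P) i.1) :=
        SeminormSpace.continuous_toSpace i.2
      set p := SeminormSpace.toSpace (P := P) i.1
      have hle : ∀ x y, p (x * y) ≤ p x * p y := hP.subset i.2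
      have ht : Filter.Tendsto (fun z : SeminormSpace P × SeminormSpace P =>
          p (z.1 - x₀) * p (z.2 - y₀) + p (z.1 - x₀) * p y₀ + p x₀ * p (z.2 - y₀))
          (nhds (x₀, y₀)) (nhds 0) := by
        have hc : Continuous (fun z : SeminormSpace P × SeminormSpace P =>
          p (z.1 - x₀) * p (z.2 - y₀) + p (z.1 - x₀) * p y₀ + p x₀ * p (z.2 - y₀)) := by fun_prop
        simpa using hc.tendsto (x₀, y₀)
      filter_upwards [ht.eventually (gt_mem_nhds hε)] with z hz
      refine lt_of_le_of_lt ?_ hz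
      have : z.1 * z.2 - x₀ * y₀ =
          (z.1 - x₀) * (z.2 - y₀) + (z.1 - x₀) * y₀ + x₀ * (z.2 - y₀) := by noncomm_ring
      change p (z.1 * z.2 - x₀ * y₀) ≤ _
      rw [this]
      exact (map_add_le_add p _ _).trans (add_le_add ((map_add_le_add p _ _).trans
        (add_le_add (hle _ _) (hle _ _))) (hle _ _))


variable {P}

theorem of_mul [IsSubmultiplicative P] (a b : B) :
    SeminormCompletion.of P (a * b) = SeminormCompletion.of P a * SeminormCompletion.of P b :=
  Completion.coe_mul (α := SeminormSpace P) _ _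

theorem of_one [IsSubmultiplicative P] :
    SeminormCompletion.of P (1 : B) = 1 := rfl

end

instance (B : Type*) [Ring B] [Algebra ℂ B] : IsSubmultiplicative (submultSeminorms B) := ⟨le_rfl⟩

/-- The Arens-Michael envelope of an algebra: its completion with respect to all submultiplicative
seminorms. -/
abbrev Envelope (B : Type*) [Ring B] [Algebra ℂ B] : Type _ :=
  SeminormCompletion (submultSeminorms B)

theorem submult_sup {B : Type*} [Ring B] [Algebra ℂ B] {p q : Seminorm ℂ B}
    (hp : p ∈ submultSeminorms B) (hq : q ∈ submultSeminorms B) : p ⊔ q ∈ submultSeminorms B := by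
  intro a b
  refine sup_le ((hp a b).trans ?_) ((hq a b).trans ?_)
  · exact mul_le_mul le_sup_left le_sup_left (apply_nonneg _ _)
      ((apply_nonneg p a).trans le_sup_left)
  · exact mul_le_mul le_sup_right le_sup_right (apply_nonneg _ _)
      ((apply_nonneg p a).trans le_sup_left)

theorem submult_smul {B : Type*} [Ring B] [Algebra ℂ B] {p : Seminorm ℂ B}
    (hp : p ∈ submultSeminorms B) {C : NNReal} (hC : 1 ≤ C) : C • p ∈ submultSeminorms B := by
  intro a b
  change (C : ℝ) * _ ≤ (C : ℝ) * _ * ((C : ℝ) * _)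
  have h1 : (1 : ℝ) ≤ C := by exact_mod_cast hC
  have h2 := mul_nonneg (apply_nonneg p a) (apply_nonneg p b)
  nlinarith [hp a b, mul_nonneg (sub_nonneg.mpr h1) h2, mul_nonneg (by linarith : (0:ℝ) ≤ C) (mul_nonneg (sub_nonneg.mpr h1) h2)]

theorem saturated_submultSeminorms (B : Type*) [Ring B] [Algebra ℂ B] :
    Saturated (submultSeminorms B) where
  zero_mem := fun a b => by simp
  sup_mem := fun _ hp _ hq => submult_sup hp hq
  smul_mem := fun _ hp _ hC => submult_smul hp hC

section Module

variable {H A : Type*} [Ring H] [Algebra ℂ H] [Ring A] [Algebra ℂ A]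
  (act : H →ₐ[ℂ] Module.End ℂ A)

/-- The seminorm `p` on the left `H`-module `A` (with action `h · a = act h a`) is `H`-stable. -/
def IsStable (p : Seminorm ℂ A) : Prop := ∀ h, ∃ C > 0, ∀ a, p (act h a) ≤ C * p a

/-- The set of all `H`-stable submultiplicative seminorms on `A`. -/
def stableSeminorms : Set (Seminorm ℂ A) := {p | p ∈ submultSeminorms A ∧ IsStable act p}

instance : IsSubmultiplicative (stableSeminorms act) := ⟨fun _ h => h.1⟩

/-- The `H`-completion of `A`: the completion with respect to all `H`-stable submultiplicative
seminorms. -/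
abbrev HCompletion : Type _ := SeminormCompletion (stableSeminorms act)

theorem saturated_stableSeminorms : Saturated (stableSeminorms act) where
  zero_mem := ⟨(saturated_submultSeminorms A).zero_mem, fun h => ⟨1, one_pos, fun a => by simp⟩⟩
  sup_mem := by
    rintro p ⟨hp, hps⟩ q ⟨hq, hqs⟩
    refine ⟨submult_sup hp hq, fun h => ?_⟩
    obtain ⟨C, hC, hpC⟩ := hps h
    obtain ⟨D, hD, hqD⟩ := hqs h
    refine ⟨C ⊔ D, lt_sup_of_lt_left hC, fun a => ?_⟩
    refine sup_le ((hpC a).trans ?_) ((hqD a).trans ?_)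
    · exact mul_le_mul le_sup_left le_sup_left (apply_nonneg _ _) (hC.le.trans le_sup_left)
    · exact mul_le_mul le_sup_right le_sup_right (apply_nonneg _ _) (hC.le.trans le_sup_left)
  smul_mem := by
    rintro p ⟨hp, hps⟩ K hK
    refine ⟨submult_smul hp hK, fun h => ?_⟩
    obtain ⟨C, hC, hpC⟩ := hps h
    refine ⟨C, hC, fun a => ?_⟩
    change (K : ℝ) * _ ≤ C * ((K : ℝ) * _)
    rw [mul_left_comm]
    exact mul_le_mul_of_nonneg_left (hpC a) K.2

/-- The operator seminorm on `H` defined by a stable seminorm on `A`. -/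
theorem exists_opSeminorm {p : Seminorm ℂ A} (hp : IsStable act p) :
    ∃ q ∈ submultSeminorms H, ∀ h a, p (act h a) ≤ q h * p a := by
  let S : H → Set ℝ := fun h => {C | 0 ≤ C ∧ ∀ a, p (act h a) ≤ C * p a}
  have hne : ∀ h, (S h).Nonempty := fun h => by
    obtain ⟨C, hC, h'⟩ := hp h
    exact ⟨C, hC.le, h'⟩
  have hbdd : ∀ h, BddBelow (S h) := fun h => ⟨0, fun C hC => hC.1⟩
  have hnn : ∀ h, 0 ≤ sInf (S h) := fun h => le_csInf (hne h) fun C hC => hC.1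
  have hle : ∀ h a, p (act h a) ≤ sInf (S h) * p a := by
    intro h a
    rcases (apply_nonneg p a).eq_or_lt with h0 | h0
    · obtain ⟨C, hC⟩ := hne h
      have := hC.2 a
      rw [← h0, mul_zero] at this ⊢
      exact this
    · rw [← div_le_iff₀ h0]
      exact le_csInf (hne h) fun C hC => (div_le_iff₀ h0).mpr (hC.2 a)
  refine ⟨Seminorm.ofSMulLE (fun h => sInf (S h)) ?_ ?_ ?_, ?_, hle⟩
  · exact le_antisymm (csInf_le (hbdd 0) ⟨le_rfl, fun a => by simp⟩) (hnn 0)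
  · intro h k
    refine csInf_le (hbdd _) ⟨add_nonneg (hnn h) (hnn k), fun a => ?_⟩
    rw [map_add, LinearMap.add_apply, add_mul]
    exact (map_add_le_add p _ _).trans (add_le_add (hle h a) (hle k a))
  · intro c h
    refine csInf_le (hbdd _) ⟨mul_nonneg (norm_nonneg c) (hnn h), fun a => ?_⟩
    rw [map_smul, LinearMap.smul_apply, map_smul_eq_mul, mul_assoc]
    exact mul_le_mul_of_nonneg_left (hle h a) (norm_nonneg c)
  · intro h k
    refine csInf_le (hbdd _) ⟨mul_nonneg (hnn h) (hnn k), fun a => ?_⟩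
    rw [map_mul, Module.End.mul_apply, mul_assoc]
    exact (hle h _).trans (mul_le_mul_of_nonneg_left (hle k a) (hnn h))

/-- The action of `H` on `A`, with values in the `H`-completion of `A`. -/
def actAux : SeminormSpace (submultSeminorms H) →ₗ[ℂ] SeminormSpace (stableSeminorms act) →ₗ[ℂ]
    HCompletion act :=
  ((act.toLinearMap : H →ₗ[ℂ] A →ₗ[ℂ] A).compr₂ (SeminormCompletion.of (stableSeminorms act))).compl₁₂
    (SeminormSpace.mk (submultSeminorms H)).symm.toLinearMap
    (SeminormSpace.mk (stableSeminorms act)).symm.toLinearMap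

theorem jointlyBounded_actAux : JointlyBounded (actAux act) := by
  intro s hs
  obtain ⟨p, hp, hle⟩ := SeminormSpace.exists_le (saturated_stableSeminorms act)
    (s := s.comp (SeminormCompletion.coeL (stableSeminorms act)).toLinearMap)
    (hs.comp (SeminormCompletion.coeL (stableSeminorms act)).continuous)
  obtain ⟨q, hq, hle'⟩ := exists_opSeminorm act hp.2
  exact ⟨SeminormSpace.toSpace q, SeminormSpace.continuous_toSpace hq,
    SeminormSpace.toSpace p, SeminormSpace.continuous_toSpace hp,
    fun h a => (hle _).trans (hle' _ _)⟩

/-- The action of the Arens-Michael envelope of `H` on the `H`-completion of `A`, extending the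
action of `H` on `A` by continuity. -/
def envelopeAct : CTensor (Envelope H) (HCompletion act) →L[ℂ] HCompletion act :=
  clift (extendLeft (extendLeft (actAux act) (jointlyBounded_actAux act)).flip
      (jointlyBounded_extendLeft _ (jointlyBounded_actAux act)).flip).flip
    (jointlyBounded_extendLeft _ (jointlyBounded_extendLeft _ (jointlyBounded_actAux act)).flip).flip

theorem envelopeAct_of (h : H) (a : A) :
    envelopeAct act (ctmul (SeminormCompletion.of _ h) (SeminormCompletion.of _ a)) =
      SeminormCompletion.of _ (act h a) := by
  rw [envelopeAct, clift_ctmul, LinearMap.flip_apply, extendLeft_of, LinearMap.flip_apply,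
    extendLeft_of]
  rfl

end Module

end Algebras

section Mul

/-- The multiplication `B ⊗ B → B` of a complete locally convex algebra with jointly continuous
multiplication, on the completed projective tensor product. -/
def cmulMap (B : Type*) [Ring B] [Algebra ℂ B] [UniformSpace B] [IsUniformAddGroup B]
    [IsTopologicalRing B] [ContinuousSMul ℂ B] [PolynormableSpace ℂ B] [CompleteSpace B]
    [T0Space B] : CTensor B B →L[ℂ] B :=
  clift (LinearMap.mul ℂ B) (JointlyBounded.of_continuous continuous_mul)

theorem cmulMap_ctmul {B : Type*} [Ring B] [Algebra ℂ B] [UniformSpace B] [IsUniformAddGroup B]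
    [IsTopologicalRing B] [ContinuousSMul ℂ B] [PolynormableSpace ℂ B] [CompleteSpace B]
    [T0Space B] (x y : B) : cmulMap B (ctmul x y) = x * y :=
  clift_ctmul _ _ x y

end Mul

section Comul

variable {V W : Type*} [AddCommGroup V] [Module ℂ V] [AddCommGroup W] [Module ℂ W]

/-- The canonical map from the algebraic tensor product `V ⊗ W` to the completed projective tensor
product of completions of `V` and `W`. -/
def tensorOf (P : Set (Seminorm ℂ V)) (Q : Set (Seminorm ℂ W)) :
    V ⊗[ℂ] W →ₗ[ℂ] CTensor (SeminormCompletion P) (SeminormCompletion Q) :=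
  ctensorMap (SeminormCompletion.of P) (SeminormCompletion.of Q)

@[simp]
theorem tensorOf_tmul (P : Set (Seminorm ℂ V)) (Q : Set (Seminorm ℂ W)) (v : V) (w : W) :
    tensorOf P Q (v ⊗ₜ[ℂ] w) = ctmul (SeminormCompletion.of P v) (SeminormCompletion.of Q w) := by
  simp [tensorOf]

theorem denseRange_tensorOf (P : Set (Seminorm ℂ V)) (Q : Set (Seminorm ℂ W)) :
    DenseRange (tensorOf P Q) := by
  set M : Submodule ℂ (CTensor (SeminormCompletion P) (SeminormCompletion Q)) :=
    (LinearMap.range (tensorOf P Q)).topologicalClosure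
  have hMc : IsClosed (M : Set (CTensor (SeminormCompletion P) (SeminormCompletion Q))) :=
    Submodule.isClosed_topologicalClosure _
  have h1 : ∀ x y, ctmul x y ∈ M := by
    intro x y
    refine SeminormCompletion.denseRange_of.induction_on (p := fun x => ctmul x y ∈ M) x
      (hMc.preimage (continuous_ctmul_left y)) fun v => ?_
    refine SeminormCompletion.denseRange_of.induction_on
      (p := fun y => ctmul (SeminormCompletion.of P v) y ∈ M) y
      (hMc.preimage (continuous_ctmul_right _)) fun w => ?_
    exact Submodule.le_topologicalClosure _ ⟨v ⊗ₜ[ℂ] w, by simp⟩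
  exact fun z => ctensor_mem_of_isClosed hMc h1 z

variable {H : Type*} [Ring H] [Bialgebra ℂ H]

theorem projSeminorm_submult {B C : Type*} [Ring B] [Algebra ℂ B] [Ring C] [Algebra ℂ C]
    {p : Seminorm ℂ B} {q : Seminorm ℂ C} (hp : p ∈ submultSeminorms B)
    (hq : q ∈ submultSeminorms C) : projSeminorm p q ∈ submultSeminorms (B ⊗[ℂ] C) := by
  have h1 : ∀ x y v, projSeminorm p q ((x ⊗ₜ[ℂ] y) * v) ≤ (p x * q y) * projSeminorm p q v := by
    intro x y v
    refine le_mul_projSeminorm (r := (projSeminorm p q).comp (LinearMap.mulLeft ℂ (x ⊗ₜ[ℂ] y)))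
      (mul_nonneg (apply_nonneg p x) (apply_nonneg q y)) (fun x' y' => ?_) v
    change projSeminorm p q ((x ⊗ₜ[ℂ] y) * (x' ⊗ₜ[ℂ] y')) ≤ _
    rw [Algebra.TensorProduct.tmul_mul_tmul]
    refine (projSeminorm_tmul_le _ _ _ _).trans ((mul_le_mul (hp x x') (hq y y')
      (apply_nonneg _ _) (mul_nonneg (apply_nonneg _ _) (apply_nonneg _ _))).trans_eq ?_)
    ring
  intro u v
  rw [mul_comm (projSeminorm p q u)]
  refine le_mul_projSeminorm (r := (projSeminorm p q).comp (LinearMap.mulRight ℂ v))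
    (apply_nonneg _ _) (fun x y => ?_) u
  exact (h1 x y v).trans_eq (mul_comm _ _)

variable (H) in
/-- The comultiplication of the Arens-Michael envelope of a bialgebra `H`, extending that of `H` by
continuity. -/
def envelopeComul : Envelope H →L[ℂ] CTensor (Envelope H) (Envelope H) :=
  SeminormCompletion.extendL
    { toLinearMap := tensorOf (submultSeminorms H) (submultSeminorms H) ∘ₗ Coalgebra.comul ∘ₗ
        (SeminormSpace.mk (submultSeminorms H)).symm.toLinearMap
      cont := continuous_of_seminorms _ fun s hs => by
        obtain ⟨p, hp, q, hq, hle⟩ := jointlyBounded_ctmul (E := Envelope H) (F := Envelope H) s hs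
        obtain ⟨p', hp', hle1⟩ := SeminormSpace.exists_le (saturated_submultSeminorms H)
          (s := p.comp (SeminormCompletion.coeL (submultSeminorms H)).toLinearMap)
          (hp.comp (SeminormCompletion.coeL (submultSeminorms H)).continuous)
        obtain ⟨q', hq', hle2⟩ := SeminormSpace.exists_le (saturated_submultSeminorms H)
          (s := q.comp (SeminormCompletion.coeL (submultSeminorms H)).toLinearMap)
          (hq.comp (SeminormCompletion.coeL (submultSeminorms H)).continuous)
        have h1 : s.comp (tensorOf (submultSeminorms H) (submultSeminorms H)) ≤
            projSeminorm p' q' := le_projSeminorm fun x y => by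
          rw [Seminorm.comp_apply, tensorOf_tmul]
          exact (hle _ _).trans (mul_le_mul (hle1 x) (hle2 y) (apply_nonneg _ _)
            (apply_nonneg _ _))
        have h2 : (projSeminorm p' q').comp (Coalgebra.comul : H →ₗ[ℂ] H ⊗[ℂ] H) ∈
            submultSeminorms H := fun a b => by
          simp only [Seminorm.comp_apply, Bialgebra.comul_mul]
          exact projSeminorm_submult hp' hq' _ _
        exact ⟨SeminormSpace.toSpace _, SeminormSpace.continuous_toSpace h2, fun x => h1 _⟩ }

theorem envelopeComul_of (h : H) :
    envelopeComul H (SeminormCompletion.of _ h) = tensorOf _ _ (Coalgebra.comul (R := ℂ) h) :=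
  SeminormCompletion.extendL_of _ h

end Comul
section SmashAlgebras

variable {H A : Type*} [Ring H] [Bialgebra ℂ H] [Ring A] [Algebra ℂ A]

/-- An action `H → End A`, as a linear map `H ⊗ A → A`. -/
def actMap (act : H →ₐ[ℂ] Module.End ℂ A) : H ⊗[ℂ] A →ₗ[ℂ] A :=
  TensorProduct.lift act.toLinearMap

/-- The smash product `A # H`, which is `A ⊗ H` as a vector space. -/
def SmashProduct (_act : H →ₐ[ℂ] Module.End ℂ A) : Type _ := A ⊗[ℂ] H

/-- The analytic smash product of the `H`-completion of `A` and the Arens-Michael envelope of `H`,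
which is their completed projective tensor product as a locally convex space. -/
def AnalyticSmashProduct (act : H →ₐ[ℂ] Module.End ℂ A) : Type _ :=
  CTensor (HCompletion act) (Envelope H)

variable (act : H →ₐ[ℂ] Module.End ℂ A)

instance : AddCommGroup (SmashProduct act) := inferInstanceAs (AddCommGroup (A ⊗[ℂ] H))
instance : Module ℂ (SmashProduct act) := inferInstanceAs (Module ℂ (A ⊗[ℂ] H))

instance : AddCommGroup (AnalyticSmashProduct act) :=
  inferInstanceAs (AddCommGroup (CTensor (HCompletion act) (Envelope H)))
instance : Module ℂ (AnalyticSmashProduct act) :=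
  inferInstanceAs (Module ℂ (CTensor (HCompletion act) (Envelope H)))
instance : UniformSpace (AnalyticSmashProduct act) :=
  inferInstanceAs (UniformSpace (CTensor (HCompletion act) (Envelope H)))
instance : IsUniformAddGroup (AnalyticSmashProduct act) :=
  inferInstanceAs (IsUniformAddGroup (CTensor (HCompletion act) (Envelope H)))
instance : CompleteSpace (AnalyticSmashProduct act) :=
  inferInstanceAs (CompleteSpace (CTensor (HCompletion act) (Envelope H)))
instance : T0Space (AnalyticSmashProduct act) :=
  inferInstanceAs (T0Space (CTensor (HCompletion act) (Envelope H)))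
instance : ContinuousSMul ℂ (AnalyticSmashProduct act) :=
  inferInstanceAs (ContinuousSMul ℂ (CTensor (HCompletion act) (Envelope H)))
instance : PolynormableSpace ℂ (AnalyticSmashProduct act) :=
  inferInstanceAs (PolynormableSpace ℂ (CTensor (HCompletion act) (Envelope H)))

/-- The element `a ⊗ h` of the smash product. -/
def SmashProduct.tmul (a : A) (h : H) : SmashProduct act := a ⊗ₜ[ℂ] h

/-- The element `x ⊗ y` of the analytic smash product. -/
def AnalyticSmashProduct.tmul (x : HCompletion act) (y : Envelope H) : AnalyticSmashProduct act :=
  (ctmul x y : CTensor (HCompletion act) (Envelope H))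

/-- The multiplication of the smash product as a linear map on the tensor square. -/
def SmashProduct.mulMap : (A ⊗[ℂ] H) ⊗[ℂ] (A ⊗[ℂ] H) →ₗ[ℂ] A ⊗[ℂ] H :=
  smashMul (LinearMap.mul' ℂ A) (LinearMap.mul' ℂ H) (tau Coalgebra.comul (actMap act))

/-- The multiplication of the analytic smash product as a continuous linear map on the completed
tensor square. -/
def AnalyticSmashProduct.mulMap :
    CTensor (CTensor (HCompletion act) (Envelope H)) (CTensor (HCompletion act) (Envelope H)) →L[ℂ]
      CTensor (HCompletion act) (Envelope H) :=
  csmashMul (cmulMap (HCompletion act)) (cmulMap (Envelope H))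
    (ctau (envelopeComul H) (envelopeAct act))

/-- The multiplication of the smash product, `x * y = mulMap (x ⊗ y)`, as a bilinear map. -/
def SmashProduct.mulBilin : SmashProduct act →ₗ[ℂ] SmashProduct act →ₗ[ℂ] SmashProduct act :=
  (TensorProduct.curry (SmashProduct.mulMap act) : A ⊗[ℂ] H →ₗ[ℂ] A ⊗[ℂ] H →ₗ[ℂ] A ⊗[ℂ] H)

/-- The multiplication of the analytic smash product, `x * y = mulMap (x ⊗ y)`, as a bilinear
map. -/
def AnalyticSmashProduct.mulBilin :
    AnalyticSmashProduct act →ₗ[ℂ] AnalyticSmashProduct act →ₗ[ℂ] AnalyticSmashProduct act :=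
  (ctmul.compr₂ (AnalyticSmashProduct.mulMap act).toLinearMap :
    CTensor (HCompletion act) (Envelope H) →ₗ[ℂ] CTensor (HCompletion act) (Envelope H) →ₗ[ℂ]
      CTensor (HCompletion act) (Envelope H))

instance : Mul (SmashProduct act) := ⟨fun x y => SmashProduct.mulBilin act x y⟩
instance : One (SmashProduct act) := ⟨SmashProduct.tmul act 1 1⟩

instance : Mul (AnalyticSmashProduct act) := ⟨fun x y => AnalyticSmashProduct.mulBilin act x y⟩
instance : One (AnalyticSmashProduct act) := ⟨AnalyticSmashProduct.tmul act 1 1⟩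

/-- The canonical map from the smash product to the analytic smash product. -/
def SmashProduct.toAnalytic : SmashProduct act →ₗ[ℂ] AnalyticSmashProduct act :=
  (tensorOf (stableSeminorms act) (submultSeminorms H) :
    A ⊗[ℂ] H →ₗ[ℂ] CTensor (HCompletion act) (Envelope H))

theorem SmashProduct.toAnalytic_tmul (a : A) (h : H) :
    SmashProduct.toAnalytic act (SmashProduct.tmul act a h) =
      AnalyticSmashProduct.tmul act (SeminormCompletion.of _ a)
        (SeminormCompletion.of _ h) :=
  tensorOf_tmul _ _ a h

theorem SmashProduct.denseRange_toAnalytic : DenseRange (SmashProduct.toAnalytic act) :=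
  denseRange_tensorOf _ _

theorem ctau_of (h : H) (a : A) :
    ctau (envelopeComul H) (envelopeAct act) (ctmul (SeminormCompletion.of _ h)
      (SeminormCompletion.of _ a)) = tensorOf (stableSeminorms act) (submultSeminorms H)
        (tau Coalgebra.comul (actMap act) (h ⊗ₜ[ℂ] a)) :=
  ctau_compat (SeminormCompletion.of (stableSeminorms act))
    (SeminormCompletion.of (submultSeminorms H)) Coalgebra.comul (actMap act) (envelopeComul H)
    (envelopeAct act) envelopeComul_of (envelopeAct_of act) h a

theorem SmashProduct.toAnalytic_mul (x y : SmashProduct act) :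
    SmashProduct.toAnalytic act (x * y) =
      SmashProduct.toAnalytic act x * SmashProduct.toAnalytic act y :=
  (csmashMul_compat (SeminormCompletion.of (stableSeminorms act))
    (SeminormCompletion.of (submultSeminorms H)) (LinearMap.mul' ℂ A) (LinearMap.mul' ℂ H)
    (tau Coalgebra.comul (actMap act)) (cmulMap (HCompletion act)) (cmulMap (Envelope H))
    (ctau (envelopeComul H) (envelopeAct act))
    (fun a b => by rw [cmulMap_ctmul, ← of_mul, LinearMap.mul'_apply])
    (fun a b => by rw [cmulMap_ctmul, ← of_mul, LinearMap.mul'_apply])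
    (ctau_of act) x y).symm

instance : ContinuousMul (AnalyticSmashProduct act) where
  continuous_mul := (AnalyticSmashProduct.mulMap act).continuous.comp
    (continuous_ctmul (E := CTensor (HCompletion act) (Envelope H))
      (F := CTensor (HCompletion act) (Envelope H)))

variable {act}

theorem SmashProduct.add_mul' (x y z : SmashProduct act) : (x + y) * z = x * z + y * z :=
  LinearMap.map_add₂ (SmashProduct.mulBilin act) x y z

theorem SmashProduct.mul_add' (x y z : SmashProduct act) : x * (y + z) = x * y + x * z :=
  map_add (SmashProduct.mulBilin act x) y z

theorem SmashProduct.smul_mul' (c : ℂ) (x y : SmashProduct act) : (c • x) * y = c • (x * y) :=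
  LinearMap.map_smul₂ (SmashProduct.mulBilin act) c x y

theorem SmashProduct.mul_smul' (c : ℂ) (x y : SmashProduct act) : x * (c • y) = c • (x * y) :=
  map_smul (SmashProduct.mulBilin act x) c y

theorem SmashProduct.zero_mul' (x : SmashProduct act) : 0 * x = 0 :=
  LinearMap.map_zero₂ (SmashProduct.mulBilin act) x

theorem SmashProduct.mul_zero' (x : SmashProduct act) : x * 0 = 0 :=
  map_zero (SmashProduct.mulBilin act x)

theorem AnalyticSmashProduct.add_mul' (x y z : AnalyticSmashProduct act) :
    (x + y) * z = x * z + y * z :=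
  LinearMap.map_add₂ (AnalyticSmashProduct.mulBilin act) x y z

theorem AnalyticSmashProduct.mul_add' (x y z : AnalyticSmashProduct act) :
    x * (y + z) = x * y + x * z :=
  map_add (AnalyticSmashProduct.mulBilin act x) y z

theorem AnalyticSmashProduct.smul_mul' (c : ℂ) (x y : AnalyticSmashProduct act) :
    (c • x) * y = c • (x * y) :=
  LinearMap.map_smul₂ (AnalyticSmashProduct.mulBilin act) c x y

theorem AnalyticSmashProduct.mul_smul' (c : ℂ) (x y : AnalyticSmashProduct act) :
    x * (c • y) = c • (x * y) :=
  map_smul (AnalyticSmashProduct.mulBilin act x) c y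

theorem AnalyticSmashProduct.zero_mul' (x : AnalyticSmashProduct act) : 0 * x = 0 :=
  LinearMap.map_zero₂ (AnalyticSmashProduct.mulBilin act) x

theorem AnalyticSmashProduct.mul_zero' (x : AnalyticSmashProduct act) : x * 0 = 0 :=
  map_zero (AnalyticSmashProduct.mulBilin act x)

theorem SmashProduct.toAnalytic_one : SmashProduct.toAnalytic act 1 = 1 :=
  tensorOf_tmul _ _ 1 1

/-! The ring laws of the analytic smash product follow by continuity and density from those of the
algebraic one. -/

theorem AnalyticSmashProduct.mul_assoc'
    (h : ∀ x y z : SmashProduct act, x * y * z = x * (y * z)) (x y z : AnalyticSmashProduct act) :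
    x * y * z = x * (y * z) := by
  refine (SmashProduct.denseRange_toAnalytic act).induction_on₃
    (p := fun x y z : AnalyticSmashProduct act => x * y * z = x * (y * z))
    (isClosed_eq (by fun_prop) (by fun_prop)) (fun a b c => ?_) x y z
  simp only [← SmashProduct.toAnalytic_mul, h]

theorem AnalyticSmashProduct.one_mul' (h : ∀ x : SmashProduct act, 1 * x = x)
    (x : AnalyticSmashProduct act) : 1 * x = x := by
  refine (SmashProduct.denseRange_toAnalytic act).induction_on
    (p := fun x : AnalyticSmashProduct act => 1 * x = x) x
    (isClosed_eq (continuous_const.mul continuous_id) continuous_id) (fun a => ?_)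
  rw [← SmashProduct.toAnalytic_one, ← SmashProduct.toAnalytic_mul, h]

theorem AnalyticSmashProduct.mul_one' (h : ∀ x : SmashProduct act, x * 1 = x)
    (x : AnalyticSmashProduct act) : x * 1 = x := by
  refine (SmashProduct.denseRange_toAnalytic act).induction_on
    (p := fun x : AnalyticSmashProduct act => x * 1 = x) x
    (isClosed_eq (continuous_id.mul continuous_const) continuous_id) (fun a => ?_)
  rw [← SmashProduct.toAnalytic_one, ← SmashProduct.toAnalytic_mul, h]

end SmashAlgebras
section Group

variable {G A : Type*} [Group G] [Ring A] [Algebra ℂ A] (ρ : G →* (A ≃ₐ[ℂ] A))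

/-- The action of the group algebra `ℂG` on `A` induced by an action of `G` on `A` by
automorphisms. -/
def groupAct : MonoidAlgebra ℂ G →ₐ[ℂ] Module.End ℂ A :=
  MonoidAlgebra.lift ℂ (Module.End ℂ A) G ((AlgEquiv.toLinearMapHom ℂ A).comp ρ)

@[simp]
theorem groupAct_single (g : G) (r : ℂ) (a : A) :
    groupAct ρ (MonoidAlgebra.single g r) a = r • ρ g a := by
  simp [groupAct]

theorem SmashProduct.tmul_mul_tmul (a b : A) (g h : G) (r s : ℂ) :
    SmashProduct.tmul (groupAct ρ) a (MonoidAlgebra.single g r) *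
        SmashProduct.tmul (groupAct ρ) b (MonoidAlgebra.single h s) =
      SmashProduct.tmul (groupAct ρ) (a * ρ g b) (MonoidAlgebra.single (g * h) (r * s)) := by
  change SmashProduct.mulMap (groupAct ρ) ((a ⊗ₜ[ℂ] MonoidAlgebra.single g r) ⊗ₜ[ℂ]
    (b ⊗ₜ[ℂ] MonoidAlgebra.single h s)) = (a * ρ g b) ⊗ₜ[ℂ] MonoidAlgebra.single (g * h) (r * s)
  simp [SmashProduct.mulMap, smashMul, tau, actMap, MonoidAlgebra.comul_single,
    MonoidAlgebra.single_mul_single]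

variable {ρ} in
theorem SmashProduct.induction {motive : SmashProduct (groupAct ρ) → Prop}
    (x : SmashProduct (groupAct ρ)) (zero : motive 0)
    (tmul : ∀ a g, motive (SmashProduct.tmul (groupAct ρ) a (MonoidAlgebra.single g 1)))
    (add : ∀ x y, motive x → motive y → motive (x + y)) : motive x := by
  refine TensorProduct.induction_on (motive := motive) x zero (fun a h => ?_) add
  induction h using MonoidAlgebra.induction_linear with
  | zero => rw [TensorProduct.tmul_zero]; exact zero
  | add u v hu hv => rw [TensorProduct.tmul_add]; exact add _ _ hu hv
  | single g r =>
    have := tmul (r • a) g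
    have e : (r • a) ⊗ₜ[ℂ] MonoidAlgebra.single g (1 : ℂ) = a ⊗ₜ[ℂ] MonoidAlgebra.single g r := by
      rw [TensorProduct.smul_tmul, MonoidAlgebra.smul_single, smul_eq_mul, mul_one]
    rw [SmashProduct.tmul, e] at this
    exact this

instance : Ring (SmashProduct (groupAct ρ)) where
  __ := (inferInstance : AddCommGroup (SmashProduct (groupAct ρ)))
  __ := (inferInstance : Mul (SmashProduct (groupAct ρ)))
  __ := (inferInstance : One (SmashProduct (groupAct ρ)))
  left_distrib := SmashProduct.mul_add'
  right_distrib := SmashProduct.add_mul'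
  zero_mul := SmashProduct.zero_mul'
  mul_zero := SmashProduct.mul_zero'
  mul_assoc x y z := by
    induction x using SmashProduct.induction with
    | zero => simp only [SmashProduct.zero_mul']
    | add u v hu hv => simp only [SmashProduct.add_mul', hu, hv]
    | tmul a g =>
      induction y using SmashProduct.induction with
      | zero => simp only [SmashProduct.zero_mul', SmashProduct.mul_zero']
      | add u v hu hv => simp only [SmashProduct.add_mul', SmashProduct.mul_add', hu, hv]
      | tmul b h =>
        induction z using SmashProduct.induction with
        | zero => simp only [SmashProduct.mul_zero']
        | add u v hu hv => simp only [SmashProduct.mul_add', hu, hv]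
        | tmul c k => simp only [SmashProduct.tmul_mul_tmul, map_mul, mul_assoc, AlgEquiv.mul_apply]
  one_mul x := by
    change SmashProduct.tmul (groupAct ρ) 1 (MonoidAlgebra.single 1 1) * x = x
    induction x using SmashProduct.induction with
    | zero => simp only [SmashProduct.mul_zero']
    | add u v hu hv => simp only [SmashProduct.mul_add', hu, hv]
    | tmul a g => simp [SmashProduct.tmul_mul_tmul]
  mul_one x := by
    change x * SmashProduct.tmul (groupAct ρ) 1 (MonoidAlgebra.single 1 1) = x
    induction x using SmashProduct.induction with
    | zero => simp only [SmashProduct.zero_mul']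
    | add u v hu hv => simp only [SmashProduct.add_mul', hu, hv]
    | tmul a g => simp [SmashProduct.tmul_mul_tmul]
  zsmul := (inferInstance : AddCommGroup (SmashProduct (groupAct ρ))).zsmul

instance : Algebra ℂ (SmashProduct (groupAct ρ)) :=
  Algebra.ofModule SmashProduct.smul_mul' SmashProduct.mul_smul'

instance : Ring (AnalyticSmashProduct (groupAct ρ)) where
  __ := (inferInstance : AddCommGroup (AnalyticSmashProduct (groupAct ρ)))
  __ := (inferInstance : Mul (AnalyticSmashProduct (groupAct ρ)))
  __ := (inferInstance : One (AnalyticSmashProduct (groupAct ρ)))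
  left_distrib := AnalyticSmashProduct.mul_add'
  right_distrib := AnalyticSmashProduct.add_mul'
  zero_mul := AnalyticSmashProduct.zero_mul'
  mul_zero := AnalyticSmashProduct.mul_zero'
  mul_assoc := AnalyticSmashProduct.mul_assoc' mul_assoc
  one_mul := AnalyticSmashProduct.one_mul' one_mul
  mul_one := AnalyticSmashProduct.mul_one' mul_one
  zsmul := (inferInstance : AddCommGroup (AnalyticSmashProduct (groupAct ρ))).zsmul

instance : IsTopologicalRing (AnalyticSmashProduct (groupAct ρ)) where
  continuous_mul := continuous_mul

instance : Algebra ℂ (AnalyticSmashProduct (groupAct ρ)) :=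
  Algebra.ofModule AnalyticSmashProduct.smul_mul' AnalyticSmashProduct.mul_smul'

end Group
end

end ArensMichael

/-! Both sides contain the image of `A # ℂG` as a dense subspace, so everything reduces to comparing
two locally convex topologies on `A # ℂG`: the one given by all submultiplicative seminorms, and the
one given by projective tensor products of a stable submultiplicative seminorm on `A` with a
submultiplicative seminorm on `ℂG`. Each has to dominate the other.

Inside `A # ℂG` the action is inner: `g · a = g a g⁻¹`. Hence a submultiplicative seminorm `p` on `A
# ℂG` restricts to a seminorm on `A` that is not only submultiplicative but stable, with constant
`p(g) p(g⁻¹)` for `g` (`comp_inclLeft_mem_stableSeminorms`). Its restriction to `ℂG` is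
submultiplicative as well. The two inclusions therefore extend to the completions, and since `a ⊗ h
= (a ⊗ 1)(1 ⊗ h)`, multiplying the extensions gives a continuous map from the analytic smash product
to the envelope.

Conversely, let `p` be stable and submultiplicative on `A`, and `q` submultiplicative on `ℂG`. The
projective seminorm `p ⊗ q` need not be submultiplicative on `A # ℂG`, because `g` may distort `p`.
Still, each left multiplication is bounded for it: left multiplication by `a ⊗ g` sends `b ⊗ k` to
`a (g · b) ⊗ g k`. The operator seminorm of left multiplication is then submultiplicative, and
evaluating operators at `1` shows that a multiple of it dominates `p ⊗ q`
(`SmashProduct.exists_seminorm_le`). This makes the canonical map continuous for the envelope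
topology, so it extends to the envelope.

The two extensions are inverse to each other on the dense images of `A # ℂG`, hence everywhere, and
multiplicativity passes from `A # ℂG` to the completions by the same density. -/

namespace ArensMichael

noncomputable section

variable {G A : Type*} [Group G] [Ring A] [Algebra ℂ A] (ρ : G →* (A ≃ₐ[ℂ] A))

/-! ### The two factors inside the smash product -/

/-- The inclusion `a ↦ a ⊗ 1` of `A` into the smash product. -/
def SmashProduct.inclLeft : A →ₗ[ℂ] SmashProduct (groupAct ρ) :=
  ((TensorProduct.mk ℂ A (MonoidAlgebra ℂ G)).flip 1 : A →ₗ[ℂ] A ⊗[ℂ] MonoidAlgebra ℂ G)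

/-- The inclusion `h ↦ 1 ⊗ h` of `ℂG` into the smash product. -/
def SmashProduct.inclRight : MonoidAlgebra ℂ G →ₗ[ℂ] SmashProduct (groupAct ρ) :=
  (TensorProduct.mk ℂ A (MonoidAlgebra ℂ G) 1 :
    MonoidAlgebra ℂ G →ₗ[ℂ] A ⊗[ℂ] MonoidAlgebra ℂ G)

theorem SmashProduct.inclLeft_apply (a : A) :
    SmashProduct.inclLeft ρ a =
      SmashProduct.tmul (groupAct ρ) a (MonoidAlgebra.single (1 : G) (1 : ℂ)) := rfl

theorem SmashProduct.inclRight_apply (h : MonoidAlgebra ℂ G) :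
    SmashProduct.inclRight ρ h = SmashProduct.tmul (groupAct ρ) 1 h := rfl

theorem SmashProduct.inclLeft_mul (a b : A) :
    SmashProduct.inclLeft ρ (a * b) = SmashProduct.inclLeft ρ a * SmashProduct.inclLeft ρ b := by
  simp [SmashProduct.inclLeft_apply, SmashProduct.tmul_mul_tmul]

/-- On basis elements this holds because automorphisms fix the unit of `A`; bilinearity does the
rest. -/
theorem SmashProduct.inclRight_mul (h k : MonoidAlgebra ℂ G) :
    SmashProduct.inclRight ρ (h * k) =
      SmashProduct.inclRight ρ h * SmashProduct.inclRight ρ k := by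
  induction h using MonoidAlgebra.induction_linear with
  | zero => simp
  | add u v hu hv => simp [add_mul, hu, hv]
  | single g r =>
    induction k using MonoidAlgebra.induction_linear with
    | zero => simp
    | add u v hu hv => simp [mul_add, hu, hv]
    | single g' r' =>
      simp [SmashProduct.inclRight_apply, SmashProduct.tmul_mul_tmul,
        MonoidAlgebra.single_mul_single]

/-- This factorization dictates the formula for the inverse map `analyticToEnvelope`, and it reduces
products with a general element of `ℂG` in the second factor to products in the algebra. -/
theorem SmashProduct.inclLeft_mul_inclRight (a : A) (h : MonoidAlgebra ℂ G) :
    SmashProduct.inclLeft ρ a * SmashProduct.inclRight ρ h =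
      SmashProduct.tmul (groupAct ρ) a h := by
  induction h using MonoidAlgebra.induction_linear with
  | zero =>
    rw [map_zero, mul_zero]
    exact (TensorProduct.tmul_zero (R := ℂ) (MonoidAlgebra ℂ G) a).symm
  | add u v hu hv =>
    rw [map_add, mul_add, hu, hv]
    exact (TensorProduct.tmul_add a u v).symm
  | single g r =>
    simp [SmashProduct.inclRight_apply, SmashProduct.inclLeft_apply, SmashProduct.tmul_mul_tmul]

/-- The action becomes conjugation by an invertible element. This is what links submultiplicativity
on the smash product to stability on `A`. -/
theorem SmashProduct.inclLeft_act (g : G) (a : A) :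
    SmashProduct.inclLeft ρ (ρ g a) =
      SmashProduct.inclRight ρ (MonoidAlgebra.single g 1) * SmashProduct.inclLeft ρ a *
        SmashProduct.inclRight ρ (MonoidAlgebra.single g⁻¹ 1) := by
  simp [SmashProduct.inclRight_apply, SmashProduct.inclLeft_apply, SmashProduct.tmul_mul_tmul]

/-! ### Restriction of submultiplicative seminorms to the factors -/

variable {ρ}

/-- The elements of `ℂG` acting boundedly for `p` form a subspace, so it suffices to test the basis
`G`. -/
theorem IsStable.of_group {p : Seminorm ℂ A} (h : ∀ g, ∃ C ≥ 0, ∀ a, p (ρ g a) ≤ C * p a) :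
    IsStable (groupAct ρ) p := by
  have key : ∀ x, ∃ C ≥ 0, ∀ a, p (groupAct ρ x a) ≤ C * p a := by
    intro x
    induction x using MonoidAlgebra.induction_linear with
    | zero => exact ⟨0, le_rfl, fun a => by simp⟩
    | add u v hu hv =>
      obtain ⟨C, hC, hu⟩ := hu
      obtain ⟨D, hD, hv⟩ := hv
      refine ⟨C + D, add_nonneg hC hD, fun a => ?_⟩
      rw [map_add, LinearMap.add_apply, add_mul]
      exact (map_add_le_add p _ _).trans (add_le_add (hu a) (hv a))
    | single g r =>
      obtain ⟨C, hC, h⟩ := h g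
      refine ⟨‖r‖ * C, by positivity, fun a => ?_⟩
      rw [groupAct_single, map_smul_eq_mul, mul_assoc]
      exact mul_le_mul_of_nonneg_left (h a) (norm_nonneg r)
  intro x
  obtain ⟨C, hC, h⟩ := key x
  -- Stability asks for a strictly positive constant, while the induction only yields a nonnegative
  -- one.
  exact ⟨C + 1, by positivity, fun a => (h a).trans (by nlinarith [apply_nonneg p a])⟩

/-- Stability comes from `g · a = g a g⁻¹`: submultiplicativity applied twice bounds `p(g a g⁻¹)` by
`p(g) p(a) p(g⁻¹)`. -/
theorem comp_inclLeft_mem_stableSeminorms {p : Seminorm ℂ (SmashProduct (groupAct ρ))}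
    (hp : p ∈ submultSeminorms (SmashProduct (groupAct ρ))) :
    p.comp (SmashProduct.inclLeft ρ) ∈ stableSeminorms (groupAct ρ) := by
  refine ⟨fun a b => ?_, IsStable.of_group fun g => ?_⟩
  · simpa only [Seminorm.comp_apply, SmashProduct.inclLeft_mul] using hp _ _
  · refine ⟨p (SmashProduct.inclRight ρ (MonoidAlgebra.single g 1)) *
      p (SmashProduct.inclRight ρ (MonoidAlgebra.single g⁻¹ 1)),
      mul_nonneg (apply_nonneg _ _) (apply_nonneg _ _), fun a => ?_⟩
    rw [Seminorm.comp_apply, Seminorm.comp_apply, SmashProduct.inclLeft_act]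
    refine (hp _ _).trans ((mul_le_mul_of_nonneg_right (hp _ _) (apply_nonneg _ _)).trans_eq ?_)
    ring

theorem comp_inclRight_mem_submultSeminorms {p : Seminorm ℂ (SmashProduct (groupAct ρ))}
    (hp : p ∈ submultSeminorms (SmashProduct (groupAct ρ))) :
    p.comp (SmashProduct.inclRight ρ) ∈ submultSeminorms (MonoidAlgebra ℂ G) := fun h k => by
  simpa only [Seminorm.comp_apply, SmashProduct.inclRight_mul] using hp _ _

/-! ### Domination of projective seminorms by submultiplicative ones -/

variable (ρ) in
/-- The projective tensor product of seminorms on `A` and `ℂG`, as a seminorm on the smash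
product. -/
def SmashProduct.seminorm (p : Seminorm ℂ A) (q : Seminorm ℂ (MonoidAlgebra ℂ G)) :
    Seminorm ℂ (SmashProduct (groupAct ρ)) :=
  (projSeminorm p q : Seminorm ℂ (A ⊗[ℂ] MonoidAlgebra ℂ G))

/-- Left multiplications are bounded for the projective tensor product of a stable seminorm and a
submultiplicative seminorm. -/
theorem SmashProduct.seminorm_tmul_mul_le {p : Seminorm ℂ A} {q : Seminorm ℂ (MonoidAlgebra ℂ G)}
    (hp : p ∈ stableSeminorms (groupAct ρ)) (hq : q ∈ submultSeminorms (MonoidAlgebra ℂ G))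
    (a : A) (g : G) : ∃ C ≥ 0, ∀ y, SmashProduct.seminorm ρ p q
      (SmashProduct.tmul (groupAct ρ) a (MonoidAlgebra.single g 1) * y) ≤
        C * SmashProduct.seminorm ρ p q y := by
  obtain ⟨C, hC, h⟩ := hp.2 (MonoidAlgebra.single g 1)
  simp only [groupAct_single, one_smul] at h
  -- Here `k` is an arbitrary element of `ℂG`, not only a multiple of a group element, because the
  -- bound below must be checked on all elementary tensors.
  have e (b : A) (k : MonoidAlgebra ℂ G) :
      SmashProduct.tmul (groupAct ρ) a (MonoidAlgebra.single g 1) *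
        SmashProduct.tmul (groupAct ρ) b k =
      SmashProduct.tmul (groupAct ρ) (a * ρ g b) (MonoidAlgebra.single g 1 * k) := by
    simp only [← SmashProduct.inclLeft_mul_inclRight _ a, ← SmashProduct.inclLeft_mul_inclRight _ b,
      ← SmashProduct.inclLeft_mul_inclRight _ (a * _), SmashProduct.inclRight_mul,
      SmashProduct.inclLeft_mul, SmashProduct.inclLeft_act]
    -- With every tensor factored and the action written as conjugation, the right-hand side reads
    -- `a (g b g⁻¹) g k`; cancelling the inner `g⁻¹ g` leaves `a g b k`, the left-hand side.
    have : SmashProduct.inclRight ρ (MonoidAlgebra.single g⁻¹ 1) *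
        SmashProduct.inclRight ρ (MonoidAlgebra.single g 1) = 1 := by
      rw [← SmashProduct.inclRight_mul, MonoidAlgebra.single_mul_single, inv_mul_cancel, mul_one]
      rfl
    simp only [mul_assoc]
    rw [← mul_assoc (SmashProduct.inclRight ρ (MonoidAlgebra.single g⁻¹ 1)), this, one_mul]
  refine ⟨C * p a * q (MonoidAlgebra.single g 1), by positivity, fun y => ?_⟩
  let m : SmashProduct (groupAct ρ) →ₗ[ℂ] SmashProduct (groupAct ρ) :=
    SmashProduct.mulBilin (groupAct ρ)
      (SmashProduct.tmul (groupAct ρ) a (MonoidAlgebra.single g 1))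
  -- The projective seminorm is the largest one with the given bound on elementary tensors, so the
  -- estimate need only be verified on `b ⊗ k`. There `p (a * ρ g b) ≤ p a * (C * p b)`, and `q` is
  -- submultiplicative; this is the source of the constant.
  refine le_mul_projSeminorm (p := p) (q := q) (c := C * p a * q (MonoidAlgebra.single g 1))
    (r := (SmashProduct.seminorm ρ p q).comp m) (by positivity) (fun b k => ?_) y
  change SmashProduct.seminorm ρ p q (SmashProduct.tmul (groupAct ρ) a (MonoidAlgebra.single g 1) *
    SmashProduct.tmul (groupAct ρ) b k) ≤ _
  rw [e]
  refine (projSeminorm_tmul_le p q _ _).trans ?_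
  have h1 : p (a * ρ g b) ≤ p a * (C * p b) :=
    (hp.1 _ _).trans (mul_le_mul_of_nonneg_left (h b) (apply_nonneg _ _))
  refine (mul_le_mul h1 (hq _ _) (apply_nonneg _ _) (by positivity)).trans_eq ?_
  ring

/-- Operator seminorms are always submultiplicative, so the operator seminorm of the left regular
representation replaces `p ⊗ q`, at the price of a constant depending on the value of `p ⊗ q` at
`1`. -/
theorem SmashProduct.exists_seminorm_le {p : Seminorm ℂ A} {q : Seminorm ℂ (MonoidAlgebra ℂ G)}
    (hp : p ∈ stableSeminorms (groupAct ρ)) (hq : q ∈ submultSeminorms (MonoidAlgebra ℂ G)) :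
    ∃ r ∈ submultSeminorms (SmashProduct (groupAct ρ)),
      ∀ x, SmashProduct.seminorm ρ p q x ≤ r x := by
  -- The smash product is viewed as a left module over itself; stability then means that every left
  -- multiplication is bounded, and `exists_opSeminorm` applies.
  have hs : IsStable (Algebra.lmul ℂ (SmashProduct (groupAct ρ)))
      (SmashProduct.seminorm ρ p q) := by
    have key : ∀ x : SmashProduct (groupAct ρ), ∃ C ≥ 0, ∀ y,
        SmashProduct.seminorm ρ p q (x * y) ≤ C * SmashProduct.seminorm ρ p q y := by
      intro x
      induction x using SmashProduct.induction with
      | zero => exact ⟨0, le_rfl, fun a => by simp⟩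
      | add u v hu hv =>
        obtain ⟨C, hC, hu⟩ := hu
        obtain ⟨D, hD, hv⟩ := hv
        refine ⟨C + D, add_nonneg hC hD, fun a => ?_⟩
        rw [add_mul, add_mul]
        exact (map_add_le_add _ _ _).trans (add_le_add (hu a) (hv a))
      | tmul a g => exact SmashProduct.seminorm_tmul_mul_le hp hq a g
    intro x
    obtain ⟨C, hC, h⟩ := key x
    exact ⟨C + 1, by positivity, fun y =>
      (h y).trans (by nlinarith [apply_nonneg (SmashProduct.seminorm ρ p q) y])⟩
  obtain ⟨r, hr, hle⟩ := exists_opSeminorm _ hs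
  -- Applying left multiplication by `x` to `1` gives `(p ⊗ q)(x) ≤ r(x) K`. The factor is enlarged
  -- to `K + 1` because rescaling by a constant at least `1` preserves submultiplicativity.
  set K : NNReal := ⟨SmashProduct.seminorm ρ p q 1, apply_nonneg _ _⟩
  refine ⟨(K + 1) • r, submult_smul hr (by simp), fun x => ?_⟩
  have h1 := hle x 1
  rw [Algebra.coe_lmul_eq_mul, LinearMap.mul_apply', mul_one] at h1
  change _ ≤ ((K + 1 : NNReal) : ℝ) * r x
  have h2 : (K : ℝ) = SmashProduct.seminorm ρ p q 1 := rfl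
  push_cast
  nlinarith [apply_nonneg r x]

/-! ### The map from the envelope to the analytic smash product -/

variable (ρ)

/-- The canonical map `A # ℂG → Ã #̂ (ℂG)^` is continuous for the topology generated by the
submultiplicative seminorms. -/
def SmashProduct.toAnalyticL :
    SeminormSpace (submultSeminorms (SmashProduct (groupAct ρ))) →L[ℂ]
      AnalyticSmashProduct (groupAct ρ) where
  toLinearMap := SmashProduct.toAnalytic (groupAct ρ) ∘ₗ (SeminormSpace.mk _).symm.toLinearMap
  cont := continuous_of_seminorms _ fun s hs => by
    obtain ⟨p, hp, q, hq, hle⟩ := jointlyBounded_ctmul (E := HCompletion (groupAct ρ))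
      (F := Envelope (MonoidAlgebra ℂ G)) s hs
    -- The continuous seminorms `p` and `q` on the completions are pulled back to `A` and `ℂG`.
    -- Saturation of the defining families bounds each pullback by a single member.
    obtain ⟨p', hp', hle1⟩ := SeminormSpace.exists_le (saturated_stableSeminorms (groupAct ρ))
      (s := p.comp (SeminormCompletion.coeL (stableSeminorms (groupAct ρ))).toLinearMap)
      (hp.comp (SeminormCompletion.coeL (stableSeminorms (groupAct ρ))).continuous)
    obtain ⟨q', hq', hle2⟩ := SeminormSpace.exists_le
      (saturated_submultSeminorms (MonoidAlgebra ℂ G))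
      (s := q.comp (SeminormCompletion.coeL (submultSeminorms (MonoidAlgebra ℂ G))).toLinearMap)
      (hq.comp (SeminormCompletion.coeL (submultSeminorms (MonoidAlgebra ℂ G))).continuous)
    -- The bound holds on elementary tensors, hence everywhere by maximality of the projective
    -- seminorm.
    have h1 : Seminorm.comp s (SmashProduct.toAnalytic (groupAct ρ)) ≤
        SmashProduct.seminorm ρ p' q' := le_projSeminorm fun x y =>
      (congrArg s (tensorOf_tmul _ _ x y)).trans_le <| (hle _ _).trans <|
        mul_le_mul (hle1 x) (hle2 y) (apply_nonneg _ _) (apply_nonneg _ _)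
    obtain ⟨r, hr, h2⟩ := SmashProduct.exists_seminorm_le hp' hq'
    exact ⟨SeminormSpace.toSpace r, SeminormSpace.continuous_toSpace hr,
      fun x => (h1 _).trans (h2 _)⟩

/-- The extension of the canonical map `A # ℂG → Ã #̂ (ℂG)^` to the Arens-Michael envelope. -/
def envelopeToAnalytic :
    Envelope (SmashProduct (groupAct ρ)) →L[ℂ] AnalyticSmashProduct (groupAct ρ) :=
  SeminormCompletion.extendL (SmashProduct.toAnalyticL ρ)

theorem envelopeToAnalytic_of (x : SmashProduct (groupAct ρ)) :
    envelopeToAnalytic ρ (SeminormCompletion.of _ x) = SmashProduct.toAnalytic _ x :=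
  SeminormCompletion.extendL_of _ x

theorem envelopeToAnalytic_mul (x y : Envelope (SmashProduct (groupAct ρ))) :
    envelopeToAnalytic ρ (x * y) = envelopeToAnalytic ρ x * envelopeToAnalytic ρ y := by
  have hc := (envelopeToAnalytic ρ).continuous
  refine SeminormCompletion.denseRange_of.induction_on₂
    (p := fun x y => envelopeToAnalytic ρ (x * y) = envelopeToAnalytic ρ x * envelopeToAnalytic ρ y)
    (isClosed_eq (hc.comp continuous_mul)
      ((hc.comp continuous_fst).mul (hc.comp continuous_snd))) (fun a b => ?_) x y
  rw [← of_mul, envelopeToAnalytic_of, envelopeToAnalytic_of, envelopeToAnalytic_of,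
    SmashProduct.toAnalytic_mul]

theorem envelopeToAnalytic_one : envelopeToAnalytic ρ 1 = 1 :=
  (envelopeToAnalytic_of ρ 1).trans SmashProduct.toAnalytic_one

/-! ### The map from the analytic smash product to the envelope -/

/-- The continuous extension of a linear map which pulls back the seminorms in `Q` to seminorms
in `P`. -/
def SeminormCompletion.map {V W : Type*} [AddCommGroup V] [Module ℂ V] [AddCommGroup W]
    [Module ℂ W] {P : Set (Seminorm ℂ V)} {Q : Set (Seminorm ℂ W)} (hQ : Saturated Q)
    (f : V →ₗ[ℂ] W) (h : ∀ q ∈ Q, q.comp f ∈ P) :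
    SeminormCompletion P →L[ℂ] SeminormCompletion Q :=
  SeminormCompletion.extendL
    { toLinearMap := SeminormCompletion.of Q ∘ₗ f ∘ₗ (SeminormSpace.mk P).symm.toLinearMap
      cont := continuous_of_seminorms _ fun s hs => by
        obtain ⟨q, hq, hle⟩ := SeminormSpace.exists_le hQ
          (s := s.comp (SeminormCompletion.coeL Q).toLinearMap)
          (hs.comp (SeminormCompletion.coeL Q).continuous)
        exact ⟨SeminormSpace.toSpace _, SeminormSpace.continuous_toSpace (h q hq),
          fun x => hle _⟩ }

theorem SeminormCompletion.map_of {V W : Type*} [AddCommGroup V] [Module ℂ V] [AddCommGroup W]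
    [Module ℂ W] {P : Set (Seminorm ℂ V)} {Q : Set (Seminorm ℂ W)} (hQ : Saturated Q)
    (f : V →ₗ[ℂ] W) (h : ∀ q ∈ Q, q.comp f ∈ P) (v : V) :
    SeminormCompletion.map hQ f h (SeminormCompletion.of P v) = SeminormCompletion.of Q (f v) :=
  SeminormCompletion.extendL_of _ v

/-- The continuous extension of the inclusion of `A` into the smash product. -/
def envelopeInclLeft :
    HCompletion (groupAct ρ) →L[ℂ] Envelope (SmashProduct (groupAct ρ)) :=
  SeminormCompletion.map (saturated_submultSeminorms _) (SmashProduct.inclLeft ρ)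
    fun _ hp => comp_inclLeft_mem_stableSeminorms hp

/-- The continuous extension of the inclusion of `ℂG` into the smash product. -/
def envelopeInclRight :
    Envelope (MonoidAlgebra ℂ G) →L[ℂ] Envelope (SmashProduct (groupAct ρ)) :=
  SeminormCompletion.map (saturated_submultSeminorms _) (SmashProduct.inclRight ρ)
    fun _ hp => comp_inclRight_mem_submultSeminorms hp

/-- The map `x ⊗ y ↦ (x ⊗ 1) (1 ⊗ y)` from the analytic smash product to the Arens-Michael envelope
of the smash product. -/
def analyticToEnvelope :
    AnalyticSmashProduct (groupAct ρ) →L[ℂ] Envelope (SmashProduct (groupAct ρ)) :=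
  (clift ((LinearMap.mul ℂ (Envelope (SmashProduct (groupAct ρ)))).compl₁₂
      (envelopeInclLeft ρ).toLinearMap (envelopeInclRight ρ).toLinearMap)
    ((JointlyBounded.of_continuous continuous_mul).compl₁₂ _ _) :
    CTensor (HCompletion (groupAct ρ)) (Envelope (MonoidAlgebra ℂ G)) →L[ℂ]
      Envelope (SmashProduct (groupAct ρ)))

/-- On `a ⊗ h` the map returns the product of the images of `a ⊗ 1` and `1 ⊗ h`, which is the image
of `a ⊗ h`. With `envelopeToAnalytic_of`, this makes the two maps mutually inverse on dense
subspaces. -/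
theorem analyticToEnvelope_toAnalytic (x : SmashProduct (groupAct ρ)) :
    analyticToEnvelope ρ (SmashProduct.toAnalytic _ x) = SeminormCompletion.of _ x := by
  have key (a : A) (h : MonoidAlgebra ℂ G) :
      analyticToEnvelope ρ (AnalyticSmashProduct.tmul _ (SeminormCompletion.of _ a)
        (SeminormCompletion.of _ h)) =
        SeminormCompletion.of _ (SmashProduct.tmul (groupAct ρ) a h) := by
    refine (clift_ctmul _ _ _ _).trans ?_
    rw [← SmashProduct.inclLeft_mul_inclRight, of_mul]
    exact congrArg₂ (fun x y : Envelope (SmashProduct (groupAct ρ)) => x * y)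
      (SeminormCompletion.map_of _ _ _ _) (SeminormCompletion.map_of _ _ _ _)
  induction x using SmashProduct.induction with
  | zero => simp
  | add u v hu hv => simp only [map_add, hu, hv]
  | tmul a g => rw [SmashProduct.toAnalytic_tmul, key]

/-! ### The isomorphism -/

/-- The isomorphism between the Arens-Michael envelope of the smash product and the analytic smash
product. -/
def envelopeEquivAnalytic :
    Envelope (SmashProduct (groupAct ρ)) ≃A[ℂ] AnalyticSmashProduct (groupAct ρ) where
  toFun := envelopeToAnalytic ρ
  invFun := analyticToEnvelope ρ
  left_inv := by
    have h : analyticToEnvelope ρ ∘L envelopeToAnalytic ρ = .id ℂ _ :=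
      SeminormCompletion.ext fun x =>
        (congrArg _ (envelopeToAnalytic_of ρ x)).trans (analyticToEnvelope_toAnalytic ρ x)
    exact DFunLike.congr_fun h
  -- Two continuous maps into a Hausdorff space that agree on the dense image of `A # ℂG` are equal.
  right_inv := congrFun <| (SmashProduct.denseRange_toAnalytic (groupAct ρ)).equalizer
    ((envelopeToAnalytic ρ).continuous.comp (analyticToEnvelope ρ).continuous) continuous_id <|
    funext fun x =>
      (congrArg _ (analyticToEnvelope_toAnalytic ρ x)).trans (envelopeToAnalytic_of ρ x)
  map_mul' := envelopeToAnalytic_mul ρ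
  map_add' := map_add (envelopeToAnalytic ρ)
  commutes' r := by
    rw [Algebra.algebraMap_eq_smul_one, Algebra.algebraMap_eq_smul_one, map_smul,
      envelopeToAnalytic_one]
  continuous_toFun := (envelopeToAnalytic ρ).continuous
  continuous_invFun := (analyticToEnvelope ρ).continuous

end

end ArensMichael

/-- The formula on elementary tensors determines `Φ`, since their images span a dense subspace of
the envelope. -/
theorem mainTheorem5 {A G : Type*} [Ring A] [Algebra ℂ A] [Group G] (ρ : G →* (A ≃ₐ[ℂ] A)) :
    ∃ Φ : ArensMichael.Envelope (ArensMichael.SmashProduct (ArensMichael.groupAct ρ)) ≃A[ℂ]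
        ArensMichael.AnalyticSmashProduct (ArensMichael.groupAct ρ),
      ∀ (a : A) (h : MonoidAlgebra ℂ G),
        Φ (ArensMichael.SeminormCompletion.of _
            (ArensMichael.SmashProduct.tmul (ArensMichael.groupAct ρ) a h)) =
          ArensMichael.AnalyticSmashProduct.tmul (ArensMichael.groupAct ρ)
            (ArensMichael.SeminormCompletion.of _ a) (ArensMichael.SeminormCompletion.of _ h) :=
  ⟨ArensMichael.envelopeEquivAnalytic ρ, fun a h =>
    (ArensMichael.envelopeToAnalytic_of ρ _).trans
      (ArensMichael.SmashProduct.toAnalytic_tmul _ a h)⟩
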